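/- Let $(M,g,J)$ be a Hermitian manifold: $M$ is a smooth (finite-dimensional, boundaryless) manifold, $g=\langle\cdot,\cdot\rangle$ a smooth Riemannian metric, and $J$ an integrable complex structure on $TM$ with $\langle JX,JY\rangle=\langle X,Y\rangle$. Let $\omega(X,Y)=\langle JX,Y\rangle$ be the fundamental $2$-form, $\nabla^{LC}$ the Levi-Civita connection of $g$, and $\nabla^{SB}$ the Strominger-Bismut connection, i.e. the connection on $TM$ with $$\langle\nabla^{SB}_XY,Z\rangle=\langle\nabla^{LC}_XY,Z\rangle+\tfrac12\,(d\omega)(JX,JY,JZ).$$ For a connection $\nabla$ on $TM$ write $R(X,Y,Z,W)=\langle\nabla_X\nabla_YZ-\nabla_Y\nabla_XZ-\nabla_{[X,Y]}Z,W\rangle$ for its curvature, $T(X,Y,Z)=\langle\nabla_XY-\nabla_YX-[X,Y],Z\rangle$ for its torsion, and $\hat\nabla_{\frac{d}{dt}}$ for the induced covariant derivative of vector fields along a curve; superscripts $LC$, $SB$ indicate the connection. Let $a<b$, let $\gamma:[a,b]\to M$ be a smooth unit-speed geodesic (of $\nabla^{LC}$), and let $V,W$ be smooth vector fields along $\gamma$.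 Define the index form $$I_\gamma(V,W)=\int_a^b\Big\{\big\langle\hat\nabla^{LC}_{\frac{d}{dt}}V,\hat\nabla^{LC}_{\frac{d}{dt}}W\big\rangle-R^{LC}(V,\gamma',\gamma',W)\Big\}\,dt.$$ Then (all integrands being integrable on $[a,b]$) $$I_\gamma(V,W)=\int_a^b\Big\{\big\langle\hat\nabla^{SB}_{\frac{d}{dt}}V,\hat\nabla^{SB}_{\frac{d}{dt}}W\big\rangle+T^{SB}\big(V,\gamma',\hat\nabla^{SB}_{\frac{d}{dt}}W\big)-R^{SB}(V,\gamma',\gamma',W)\Big\}\,dt+\tfrac12T^{SB}(V,W,\gamma')\Big|_{t=a}^{t=b}.$$ In particular, $$I_\gamma(V,V)=\int_a^b\Big\{\big\langle\hat\nabla^{SB}_{\frac{d}{dt}}V,\hat\nabla^{SB}_{\frac{d}{dt}}V\big\rangle+T^{SB}\big(V,\gamma',\hat\nabla^{SB}_{\frac{d}{dt}}V\big)-R^{SB}(V,\gamma',\gamma',V)\Big\}\,dt.$$ -/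

import Mathlib

open Bundle Set MeasureTheory VectorField FiberBundle
open scoped Manifold ContDiff Topology

namespace HermitianGeometry

noncomputable section

/-! ## The Levi-Civita connection -/

section Riemannian

variable {E : Type*} [NormedAddCommGroup E] [NormedSpace ℝ E] [FiniteDimensional ℝ E]
  {M : Type*} [TopologicalSpace M] [ChartedSpace E M]
  [RiemannianBundle (fun x : M ↦ TangentSpace 𝓘(ℝ, E) x)]

instance (x : M) : FiniteDimensional ℝ (TangentSpace 𝓘(ℝ, E) x) :=
  inferInstanceAs (FiniteDimensional ℝ E)

/-- The musical isomorphism `♯`: `sharp x φ` is the tangent vector with `⟨sharp x φ, v⟩ = φ v`. -/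
def sharp (x : M) : (TangentSpace 𝓘(ℝ, E) x →L[ℝ] ℝ) →L[ℝ] TangentSpace 𝓘(ℝ, E) x :=
  haveI : CompleteSpace (TangentSpace 𝓘(ℝ, E) x) := FiniteDimensional.complete ℝ _
  { toFun := fun φ ↦ (InnerProductSpace.toDual ℝ (TangentSpace 𝓘(ℝ, E) x)).symm φ
    map_add' := fun φ ψ ↦ map_add _ φ ψ
    map_smul' := fun c φ ↦ by simp
    cont := (InnerProductSpace.toDual ℝ (TangentSpace 𝓘(ℝ, E) x)).symm.continuous }

theorem inner_sharp (x : M) (φ : TangentSpace 𝓘(ℝ, E) x →L[ℝ] ℝ)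
    (v : TangentSpace 𝓘(ℝ, E) x) : inner ℝ (sharp x φ) v = φ v := by
  have : CompleteSpace (TangentSpace 𝓘(ℝ, E) x) := FiniteDimensional.complete ℝ _
  exact InnerProductSpace.toDual_symm_apply

/-- The right-hand side of the Koszul formula for `⟨∇_X Y, Z⟩` at the point `x`. -/
def koszul (X Y Z : Π x : M, TangentSpace 𝓘(ℝ, E) x) (x : M) : ℝ :=
  2⁻¹ * (d% (fun y ↦ (inner ℝ (Y y) (Z y) : ℝ)) x (X x)
    + d% (fun y ↦ (inner ℝ (X y) (Z y) : ℝ)) x (Y x)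
    - d% (fun y ↦ (inner ℝ (X y) (Y y) : ℝ)) x (Z x)
    + inner ℝ (mlieBracket 𝓘(ℝ, E) X Y x) (Z x)
    - inner ℝ (mlieBracket 𝓘(ℝ, E) X Z x) (Y x)
    - inner ℝ (mlieBracket 𝓘(ℝ, E) Y Z x) (X x))

variable [IsManifold 𝓘(ℝ, E) ∞ M]
  [IsContMDiffRiemannianBundle 𝓘(ℝ, E) ∞ E (fun x : M ↦ TangentSpace 𝓘(ℝ, E) x)]

set_option linter.unusedSectionVars false in
theorem mdiffAt_inner {X Y : Π x : M, TangentSpace 𝓘(ℝ, E) x} {x : M}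
    (hX : MDiffAt (T% X) x) (hY : MDiffAt (T% Y) x) :
    MDiffAt (fun y ↦ (inner ℝ (X y) (Y y) : ℝ)) x :=
  MDifferentiableAt.inner_bundle (E := fun x : M ↦ TangentSpace 𝓘(ℝ, E) x) (F := E)
    (b := id) (v := X) (w := Y) hX hY

theorem koszul_tensorial_left {Y Z : Π x : M, TangentSpace 𝓘(ℝ, E) x} {x : M}
    (hY : MDiffAt (T% Y) x) (hZ : MDiffAt (T% Z) x) :
    TensorialAt 𝓘(ℝ, E) E (fun X ↦ koszul X Y Z x) x where
  smul {f X} hf hX := by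
    simp [koszul, inner_smul_left, inner_smul_right, inner_add_left,
      mlieBracket_smul_left hf hX, mvfderiv_fun_mul hf (mdiffAt_inner hX hY),
      mvfderiv_fun_mul hf (mdiffAt_inner hX hZ)]
    ring
  add {X X'} hX hX' := by
    simp [koszul, inner_add_left, inner_add_right, mlieBracket_add_left hX hX',
      mvfderiv_fun_add (mdiffAt_inner hX hY) (mdiffAt_inner hX' hY),
      mvfderiv_fun_add (mdiffAt_inner hX hZ) (mdiffAt_inner hX' hZ)]
    ring

theorem koszul_tensorial_right {X Y : Π x : M, TangentSpace 𝓘(ℝ, E) x} {x : M}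
    (hX : MDiffAt (T% X) x) (hY : MDiffAt (T% Y) x) :
    TensorialAt 𝓘(ℝ, E) E (fun Z ↦ koszul X Y Z x) x where
  smul {f Z} hf hZ := by
    simp [koszul, inner_smul_left, inner_smul_right, inner_add_left,
      mlieBracket_smul_right hf hZ, mvfderiv_fun_mul hf (mdiffAt_inner hX hZ),
      mvfderiv_fun_mul hf (mdiffAt_inner hY hZ)]
    rw [real_inner_comm (Y x) (Z x), real_inner_comm (X x) (Z x)]
    ring
  add {Z Z'} hZ hZ' := by
    simp [koszul, inner_add_left, inner_add_right, mlieBracket_add_right hZ hZ',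
      mvfderiv_fun_add (mdiffAt_inner hX hZ) (mdiffAt_inner hX hZ'),
      mvfderiv_fun_add (mdiffAt_inner hY hZ) (mdiffAt_inner hY hZ')]
    ring

theorem koszul_smul {X Y Z : Π x : M, TangentSpace 𝓘(ℝ, E) x} {f : M → ℝ} {x : M}
    (hf : MDiffAt f x) (hX : MDiffAt (T% X) x) (hY : MDiffAt (T% Y) x)
    (hZ : MDiffAt (T% Z) x) :
    koszul X (f • Y) Z x = f x * koszul X Y Z x + d% f x (X x) * inner ℝ (Y x) (Z x) := by
  simp [koszul, inner_smul_left, inner_smul_right, inner_add_left,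
    mlieBracket_smul_left hf hY, mlieBracket_smul_right hf hY,
    mvfderiv_fun_mul hf (mdiffAt_inner hX hY), mvfderiv_fun_mul hf (mdiffAt_inner hY hZ)]
  rw [real_inner_comm (X x) (Y x)]
  ring

theorem koszul_add {X Y Y' Z : Π x : M, TangentSpace 𝓘(ℝ, E) x} {x : M}
    (hX : MDiffAt (T% X) x) (hY : MDiffAt (T% Y) x) (hY' : MDiffAt (T% Y') x)
    (hZ : MDiffAt (T% Z) x) :
    koszul X (Y + Y') Z x = koszul X Y Z x + koszul X Y' Z x := by
  simp [koszul, inner_add_left, inner_add_right, mlieBracket_add_right hY hY',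
    mlieBracket_add_left hY hY',
    mvfderiv_fun_add (mdiffAt_inner hX hY) (mdiffAt_inner hX hY'),
    mvfderiv_fun_add (mdiffAt_inner hY hZ) (mdiffAt_inner hY' hZ)]
  ring

open Classical in
/-- The operator `Y ↦ ∇Y` defined by the Koszul formula (and `0` at points where `Y` is not
differentiable); `koszulConnection Y x v` is `∇_v Y`. -/
def koszulConnection (Y : Π x : M, TangentSpace 𝓘(ℝ, E) x) (x : M) :
    TangentSpace 𝓘(ℝ, E) x →L[ℝ] TangentSpace 𝓘(ℝ, E) x :=
  if hY : MDiffAt (T% Y) x then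
    (sharp x).comp (TensorialAt.mkHom₂ (I := 𝓘(ℝ, E)) (F := E) (F' := E)
      (fun X Z ↦ koszul X Y Z x) x
      (fun _ hZ ↦ koszul_tensorial_left hY hZ) (fun _ hX ↦ koszul_tensorial_right hX hY))
  else 0

theorem inner_koszulConnection {X Y Z : Π x : M, TangentSpace 𝓘(ℝ, E) x} {x : M}
    (hX : MDiffAt (T% X) x) (hY : MDiffAt (T% Y) x) (hZ : MDiffAt (T% Z) x) :
    inner ℝ (koszulConnection Y x (X x)) (Z x) = koszul X Y Z x := by
  rw [koszulConnection, dif_pos hY, ContinuousLinearMap.comp_apply, inner_sharp]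
  exact TensorialAt.mkHom₂_apply (I := 𝓘(ℝ, E)) (F := E) (F' := E)
    (Φ := fun X Z ↦ koszul X Y Z x) (fun _ hZ ↦ koszul_tensorial_left hY hZ)
    (fun _ hX ↦ koszul_tensorial_right hX hY) hX hZ

theorem inner_koszulConnection_extend {Y : Π x : M, TangentSpace 𝓘(ℝ, E) x} {x : M}
    (hY : MDiffAt (T% Y) x) (v w : TangentSpace 𝓘(ℝ, E) x) :
    inner ℝ (koszulConnection Y x v) w = koszul (extend E v) Y (extend E w) x := by
  have h := inner_koszulConnection (X := extend E v) (Z := extend E w)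
    (mdifferentiableAt_extend ..) hY (mdifferentiableAt_extend ..)
  simpa using h

variable (E M) in
/-- The Levi-Civita connection of the Riemannian metric of `M`. -/
def leviCivita : CovariantDerivative 𝓘(ℝ, E) E (fun x : M ↦ TangentSpace 𝓘(ℝ, E) x) where
  toFun := koszulConnection
  isCovariantDerivativeOnUniv :=
    { add := fun {Y Y' x} hY hY' _ ↦ by
        ext1 v
        refine ext_inner_right ℝ fun w ↦ ?_
        rw [inner_koszulConnection_extend (mdifferentiableAt_add_section hY hY'),
          koszul_add (mdifferentiableAt_extend ..) hY hY' (mdifferentiableAt_extend ..),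
          _root_.add_apply, inner_add_left, inner_koszulConnection_extend hY,
          inner_koszulConnection_extend hY']
      leibniz := fun {Y f x} hY hf _ ↦ by
        ext1 v
        refine ext_inner_right ℝ fun w ↦ ?_
        rw [inner_koszulConnection_extend (hf.smul_section hY),
          koszul_smul hf (mdifferentiableAt_extend ..) hY (mdifferentiableAt_extend ..)]
        simp [inner_add_left, inner_smul_left, inner_koszulConnection_extend hY] }

/-- The Levi-Civita connection is torsion free. -/
theorem leviCivita_torsion : (leviCivita E M).torsion = 0 := by
  rw [CovariantDerivative.torsion_eq_zero_iff]
  intro X Y x hX hY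
  refine ext_inner_right ℝ fun w ↦ ?_
  have h₁ := inner_koszulConnection (Z := extend E w) hX hY (mdifferentiableAt_extend ..)
  have h₂ := inner_koszulConnection (Z := extend E w) hY hX (mdifferentiableAt_extend ..)
  rw [extend_apply_self] at h₁ h₂
  rw [inner_sub_left]
  change inner ℝ (koszulConnection Y x (X x)) w - inner ℝ (koszulConnection X x (Y x)) w = _
  rw [h₁, h₂]
  simp [koszul, mlieBracket_swap_apply (V := Y) (W := X), real_inner_comm (X _) (Y _)]
  ring

/-- The Levi-Civita connection is compatible with the metric. -/
theorem leviCivita_metric {X Y Z : Π x : M, TangentSpace 𝓘(ℝ, E) x} {x : M}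
    (hX : MDiffAt (T% X) x) (hY : MDiffAt (T% Y) x) (hZ : MDiffAt (T% Z) x) :
    d% (fun y ↦ (inner ℝ (Y y) (Z y) : ℝ)) x (X x) =
      inner ℝ (leviCivita E M Y x (X x)) (Z x) + inner ℝ (Y x) (leviCivita E M Z x (X x)) := by
  have h₁ := inner_koszulConnection hX hY hZ
  have h₂ := inner_koszulConnection hX hZ hY
  change _ = inner ℝ (koszulConnection Y x (X x)) (Z x)
    + inner ℝ (Y x) (koszulConnection Z x (X x))
  rw [real_inner_comm _ (Y x), h₁, h₂]
  simp [koszul, mlieBracket_swap_apply (V := Z) (W := Y), real_inner_comm (Y _) (Z _)]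
  ring

end Riemannian

/-! ## Exterior derivative of differential forms -/

section Forms

variable {E : Type*} [NormedAddCommGroup E] [NormedSpace ℝ E]
  {M : Type*} [TopologicalSpace M] [ChartedSpace E M]

/-- The exterior derivative of a differential `k`-form on `M`, computed at `x` in the preferred
chart `φ` at `x`: `(dη)_x = φ^* (d ((φ⁻¹)^* η))`. -/
def extDerivForm {k : ℕ} (η : Π x : M, TangentSpace 𝓘(ℝ, E) x [⋀^Fin k]→L[ℝ] ℝ) (x : M) :
    TangentSpace 𝓘(ℝ, E) x [⋀^Fin (k + 1)]→L[ℝ] ℝ :=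
  (show TangentSpace 𝓘(ℝ, E) (extChartAt 𝓘(ℝ, E) x x) [⋀^Fin (k + 1)]→L[ℝ] ℝ from
    extDeriv (E := E) (fun y : E ↦ (η ((extChartAt 𝓘(ℝ, E) x).symm y)).compContinuousLinearMap
      (mfderiv 𝓘(ℝ, E) 𝓘(ℝ, E) (extChartAt 𝓘(ℝ, E) x).symm y))
      (extChartAt 𝓘(ℝ, E) x x)).compContinuousLinearMap
    (mfderiv 𝓘(ℝ, E) 𝓘(ℝ, E) (extChartAt 𝓘(ℝ, E) x) x)

theorem update_vec3 {V : Type*} (u v w z : V) :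
    Function.update ![u, v, w] 0 z = ![z, v, w] ∧ Function.update ![u, v, w] 1 z = ![u, z, w] ∧
      Function.update ![u, v, w] 2 z = ![u, v, z] := by
  refine ⟨?_, ?_, ?_⟩ <;> ext i <;> fin_cases i <;> rfl

/-- A `3`-form on `V` as the trilinear map `(u, v, w) ↦ β(u, v, w)`. -/
def threeFormCurry {V : Type*} [AddCommGroup V] [Module ℝ V] [TopologicalSpace V]
    (β : V [⋀^Fin 3]→L[ℝ] ℝ) : V →ₗ[ℝ] V →ₗ[ℝ] V →ₗ[ℝ] ℝ :=
  LinearMap.mk₂ ℝ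
    (fun u v ↦
      { toFun := fun w ↦ β ![u, v, w]
        map_add' := fun w w' ↦ by
          have hβ := β.map_update_add ![u, v, 0] 2 w w'
          simp only [update_vec3] at hβ
          exact hβ
        map_smul' := fun c w ↦ by
          have hβ := β.map_update_smul ![u, v, 0] 2 c w
          simp only [update_vec3] at hβ
          exact hβ })
    (fun u u' v ↦ by
      ext w
      have hβ := β.map_update_add ![0, v, w] 0 u u'
      simp only [update_vec3] at hβ
      exact hβ)
    (fun c u v ↦ by
      ext w
      have hβ := β.map_update_smul ![0, v, w] 0 c u
      simp only [update_vec3] at hβ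
      exact hβ)
    (fun u v v' ↦ by
      ext w
      have hβ := β.map_update_add ![u, 0, w] 1 v v'
      simp only [update_vec3] at hβ
      exact hβ)
    (fun c u v ↦ by
      ext w
      have hβ := β.map_update_smul ![u, 0, w] 1 c v
      simp only [update_vec3] at hβ
      exact hβ)

end Forms

/-! ## Hermitian manifolds and the Strominger-Bismut connection -/

section Hermitian

/-- An integrable complex structure `J` on `M` which is compatible with the Riemannian metric.
Integrability is the vanishing of the Nijenhuis tensor. -/
structure HermitianStructure (E : Type*) [NormedAddCommGroup E] [NormedSpace ℝ E]
    (M : Type*) [TopologicalSpace M] [ChartedSpace E M] [IsManifold 𝓘(ℝ, E) ∞ M]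
    [RiemannianBundle (fun x : M ↦ TangentSpace 𝓘(ℝ, E) x)] where
  /-- The complex structure on the tangent spaces. -/
  J (x : M) : TangentSpace 𝓘(ℝ, E) x →L[ℝ] TangentSpace 𝓘(ℝ, E) x
  contMDiff_J : ContMDiff 𝓘(ℝ, E) (𝓘(ℝ, E).prod 𝓘(ℝ, E →L[ℝ] E)) ∞
    (fun x : M ↦ (TotalSpace.mk' (E →L[ℝ] E) x (J x) :
      TotalSpace (E →L[ℝ] E)
        (fun x : M ↦ TangentSpace 𝓘(ℝ, E) x →L[ℝ] TangentSpace 𝓘(ℝ, E) x)))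
  J_J (x : M) (v : TangentSpace 𝓘(ℝ, E) x) : J x (J x v) = -v
  inner_J_J (x : M) (v w : TangentSpace 𝓘(ℝ, E) x) :
    (inner ℝ (J x v) (J x w) : ℝ) = inner ℝ v w
  nijenhuis_eq_zero (X Y : Π x : M, TangentSpace 𝓘(ℝ, E) x) (x : M)
    (hX : MDiffAt (T% X) x) (hY : MDiffAt (T% Y) x) :
    mlieBracket 𝓘(ℝ, E) (fun y ↦ J y (X y)) (fun y ↦ J y (Y y)) x
      - J x (mlieBracket 𝓘(ℝ, E) (fun y ↦ J y (X y)) Y x)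
      - J x (mlieBracket 𝓘(ℝ, E) X (fun y ↦ J y (Y y)) x)
      - mlieBracket 𝓘(ℝ, E) X Y x = 0

variable {E : Type*} [NormedAddCommGroup E] [NormedSpace ℝ E]
  {M : Type*} [TopologicalSpace M] [ChartedSpace E M] [IsManifold 𝓘(ℝ, E) ∞ M]
  [RiemannianBundle (fun x : M ↦ TangentSpace 𝓘(ℝ, E) x)]

theorem HermitianStructure.inner_J_self (h : HermitianStructure E M) (x : M)
    (v : TangentSpace 𝓘(ℝ, E) x) : (inner ℝ (h.J x v) v : ℝ) = 0 := by
  have h₁ := h.inner_J_J x (h.J x v) v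
  rw [h.J_J, inner_neg_left, real_inner_comm] at h₁
  linarith

/-- The fundamental `2`-form `ω(X, Y) = ⟨J X, Y⟩`. -/
def HermitianStructure.fundamentalForm (h : HermitianStructure E M) (x : M) :
    TangentSpace 𝓘(ℝ, E) x [⋀^Fin 2]→L[ℝ] ℝ where
  toFun := fun v ↦ inner ℝ (h.J x (v 0)) (v 1)
  map_update_add' := fun v i a b ↦ by
    fin_cases i <;> simp [inner_add_left, inner_add_right]
  map_update_smul' := fun v i c a ↦ by
    fin_cases i <;> simp [inner_smul_left, inner_smul_right]
  cont := by fun_prop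
  map_eq_zero_of_eq' := fun v i j hv hij ↦ by
    have h01 : v 0 = v 1 := by fin_cases i <;> fin_cases j <;> simp_all
    rw [h01, h.inner_J_self]

variable [FiniteDimensional ℝ E]

/-- The bilinear map `A` with `⟨A(Y, X), Z⟩ = (1 / 2) dω(J X, J Y, J Z)`. -/
def HermitianStructure.bismutForm (h : HermitianStructure E M) (x : M) :
    TangentSpace 𝓘(ℝ, E) x →L[ℝ] TangentSpace 𝓘(ℝ, E) x →L[ℝ] TangentSpace 𝓘(ℝ, E) x :=
  ((threeFormCurry
      ((extDerivForm h.fundamentalForm x).compContinuousLinearMap (h.J x))).flip.compr₂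
    ((1 / 2 : ℝ) • ((sharp x).toLinearMap ∘ₗ
      LinearMap.toContinuousLinearMap.toLinearMap))).toContinuousBilinearMap

theorem HermitianStructure.inner_bismutForm (h : HermitianStructure E M) (x : M)
    (X Y Z : TangentSpace 𝓘(ℝ, E) x) :
    inner ℝ (h.bismutForm x Y X) Z =
      (1 / 2) * extDerivForm h.fundamentalForm x ![h.J x X, h.J x Y, h.J x Z] := by
  have h₁ : h.bismutForm x Y X = (1 / 2 : ℝ) • sharp x (threeFormCurry
      ((extDerivForm h.fundamentalForm x).compContinuousLinearMap (h.J x))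
        X Y).toContinuousLinearMap := rfl
  have h₂ : threeFormCurry ((extDerivForm h.fundamentalForm x).compContinuousLinearMap (h.J x))
      X Y Z = extDerivForm h.fundamentalForm x ![h.J x X, h.J x Y, h.J x Z] := by
    change extDerivForm h.fundamentalForm x (h.J x ∘ ![X, Y, Z]) = _
    congr 1
    ext i
    fin_cases i <;> rfl
  rw [h₁, real_inner_smul_left, inner_sharp, LinearMap.coe_toContinuousLinearMap', h₂]

variable [IsContMDiffRiemannianBundle 𝓘(ℝ, E) ∞ E (fun x : M ↦ TangentSpace 𝓘(ℝ, E) x)]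

/-- The Strominger-Bismut connection:
`⟨∇^SB_X Y, Z⟩ = ⟨∇^LC_X Y, Z⟩ + (1 / 2) dω(J X, J Y, J Z)`. -/
def HermitianStructure.bismut (h : HermitianStructure E M) :
    CovariantDerivative 𝓘(ℝ, E) E (fun x : M ↦ TangentSpace 𝓘(ℝ, E) x) :=
  (leviCivita E M).addOneForm h.bismutForm

theorem HermitianStructure.inner_bismut (h : HermitianStructure E M)
    (X Y Z : Π x : M, TangentSpace 𝓘(ℝ, E) x) (x : M) :
    inner ℝ (h.bismut Y x (X x)) (Z x) = inner ℝ (leviCivita E M Y x (X x)) (Z x) +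
      (1 / 2) * extDerivForm h.fundamentalForm x
        ![h.J x (X x), h.J x (Y x), h.J x (Z x)] := by
  rw [← h.inner_bismutForm, ← inner_add_left]
  rfl

end Hermitian

/-! ## Curvature, torsion, and covariant differentiation along a curve -/

section Connections

variable {E : Type*} [NormedAddCommGroup E] [NormedSpace ℝ E]
  {M : Type*} [TopologicalSpace M] [ChartedSpace E M] [IsManifold 𝓘(ℝ, E) ∞ M]

/-- The curvature `R(u, v) w = ∇_X ∇_Y Z - ∇_Y ∇_X Z - ∇_[X, Y] Z` at `x`, where `X`, `Y`, `Z` are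
the vector fields extending `u`, `v`, `w` with constant components in the chart at `x`. -/
def curvature (D : CovariantDerivative 𝓘(ℝ, E) E (fun x : M ↦ TangentSpace 𝓘(ℝ, E) x)) (x : M)
    (u v w : TangentSpace 𝓘(ℝ, E) x) : TangentSpace 𝓘(ℝ, E) x :=
  let X : Π y : M, TangentSpace 𝓘(ℝ, E) y := extend E u
  let Y : Π y : M, TangentSpace 𝓘(ℝ, E) y := extend E v
  let Z : Π y : M, TangentSpace 𝓘(ℝ, E) y := extend E w
  D (fun y ↦ D Z y (Y y)) x (X x) - D (fun y ↦ D Z y (X y)) x (Y x)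
    - D Z x (mlieBracket 𝓘(ℝ, E) X Y x)

/-- The velocity `γ'(t)` of a curve `γ : [a, b] → M` (one-sided at the end points). -/
def velocity (γ : ℝ → M) (a b t : ℝ) : TangentSpace 𝓘(ℝ, E) (γ t) :=
  mfderivWithin 𝓘(ℝ, ℝ) 𝓘(ℝ, E) γ (Icc a b) t (1 : ℝ)

/-- The covariant derivative `∇̂_{d/dt} V` of a vector field `V` along `γ : [a, b] → M` for the
connection induced by `D` on `γ^* TM`. In the coordinate frame `(e_i)` of the chart at `γ t` one
has `V = u^i e_i` along `γ`, and the value at `t` is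
`(du^i / dt) e_i + u^i ∇_{γ'} e_i`, where `u^i(t) e_i` is the extension of `V t` with constant
components. -/
def covDerivAlong (D : CovariantDerivative 𝓘(ℝ, E) E (fun x : M ↦ TangentSpace 𝓘(ℝ, E) x))
    (γ : ℝ → M) (a b : ℝ) (V : Π t : ℝ, TangentSpace 𝓘(ℝ, E) (γ t)) (t : ℝ) :
    TangentSpace 𝓘(ℝ, E) (γ t) :=
  (trivializationAt E (TangentSpace 𝓘(ℝ, E) : M → Type _) (γ t)).symm (γ t)
      (derivWithin (fun s ↦ (trivializationAt E (TangentSpace 𝓘(ℝ, E) : M → Type _) (γ t)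
        (TotalSpace.mk' E (γ s) (V s))).2) (Icc a b) t)
    + D (extend E (V t)) (γ t) (velocity γ a b t)

/-- `V` is a smooth vector field along `γ : [a, b] → M`. -/
def IsSmoothAlong (γ : ℝ → M) (a b : ℝ) (V : Π t : ℝ, TangentSpace 𝓘(ℝ, E) (γ t)) : Prop :=
  ContMDiffOn 𝓘(ℝ, ℝ) 𝓘(ℝ, E).tangent ∞
    (fun t ↦ (TotalSpace.mk' E (γ t) (V t) : TangentBundle 𝓘(ℝ, E) M)) (Icc a b)

variable [RiemannianBundle (fun x : M ↦ TangentSpace 𝓘(ℝ, E) x)]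

/-- `R(u, v, w, z) = ⟨R(u, v) w, z⟩`. -/
def curvatureTensor (D : CovariantDerivative 𝓘(ℝ, E) E (fun x : M ↦ TangentSpace 𝓘(ℝ, E) x))
    (x : M) (u v w z : TangentSpace 𝓘(ℝ, E) x) : ℝ :=
  inner ℝ (curvature D x u v w) z

variable [FiniteDimensional ℝ E]

/-- `T(u, v, w) = ⟨∇_X Y - ∇_Y X - [X, Y], w⟩` for `X`, `Y` extending `u`, `v`. -/
def torsionTensor (D : CovariantDerivative 𝓘(ℝ, E) E (fun x : M ↦ TangentSpace 𝓘(ℝ, E) x))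
    (x : M) (u v w : TangentSpace 𝓘(ℝ, E) x) : ℝ :=
  inner ℝ (D.torsion x u v) w

variable [IsContMDiffRiemannianBundle 𝓘(ℝ, E) ∞ E (fun x : M ↦ TangentSpace 𝓘(ℝ, E) x)]

/-- `γ : [a, b] → M` is a smooth geodesic of the Levi-Civita connection with `|γ'| = 1`. -/
structure IsUnitSpeedGeodesic (γ : ℝ → M) (a b : ℝ) : Prop where
  contMDiffOn : ContMDiffOn 𝓘(ℝ, ℝ) 𝓘(ℝ, E) ∞ γ (Icc a b)
  unit_speed : ∀ t ∈ Icc a b,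
    (inner ℝ (velocity (E := E) γ a b t) (velocity (E := E) γ a b t) : ℝ) = 1
  geodesic : ∀ t ∈ Icc a b,
    covDerivAlong (leviCivita E M) γ a b (velocity (E := E) γ a b) t = 0

/-- The integrand of the Riemannian index form. -/
def indexIntegrand (γ : ℝ → M) (a b : ℝ) (V W : Π t : ℝ, TangentSpace 𝓘(ℝ, E) (γ t))
    (t : ℝ) : ℝ :=
  inner ℝ (covDerivAlong (leviCivita E M) γ a b V t) (covDerivAlong (leviCivita E M) γ a b W t)
    - curvatureTensor (leviCivita E M) (γ t) (V t) (velocity γ a b t) (velocity γ a b t) (W t)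

/-- The Riemannian index form `I_γ(V, W)`. -/
def indexForm (γ : ℝ → M) (a b : ℝ) (V W : Π t : ℝ, TangentSpace 𝓘(ℝ, E) (γ t)) : ℝ :=
  ∫ t in a..b, indexIntegrand γ a b V W t

/-- The integrand
`⟨∇̂^SB V, ∇̂^SB W⟩ + T^SB(V, γ', ∇̂^SB W) - R^SB(V, γ', γ', W)`. -/
def HermitianStructure.bismutIntegrand (h : HermitianStructure E M) (γ : ℝ → M) (a b : ℝ)
    (V W : Π t : ℝ, TangentSpace 𝓘(ℝ, E) (γ t)) (t : ℝ) : ℝ :=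
  inner ℝ (covDerivAlong h.bismut γ a b V t) (covDerivAlong h.bismut γ a b W t)
    + torsionTensor h.bismut (γ t) (V t) (velocity γ a b t) (covDerivAlong h.bismut γ a b W t)
    - curvatureTensor h.bismut (γ t) (V t) (velocity γ a b t) (velocity γ a b t) (W t)

end Connections

end

end HermitianGeometry

open HermitianGeometry

/-! Write ∇^SB = ∇^LC + A, where ⟨A(X,Y),Z⟩ = ½ dω(JX,JY,JZ). What drives the computation is that
this trilinear form is totally skew: since ∇^LC is torsion free, T^SB(X,Y,Z) = 2⟨A(X,Y),Z⟩, so the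
boundary term is built from F(t) = ⟨A(V,W),γ'⟩. The theorem is the fundamental theorem of calculus
for F once F' is known to be the difference of the two integrands, LC minus SB
(`HermitianStructure.derivWithin_torsionTensor_velocity`).

To see the pointwise identity, let a dot denote ∇̂^LC and put ξ = γ'. In the SB integrand the
derivative and torsion terms give ⟨V̇,Ẇ⟩ − ⟨A(ξ,V),Ẇ⟩ + ⟨V̇,A(ξ,W)⟩ − ⟨A(ξ,V),A(ξ,W)⟩. Skewness
removes the terms containing A(ξ,ξ) and its covariant derivative from the curvature, leaving
R^SB(V,ξ)ξ = R^LC(V,ξ)ξ − (∇_ξ A)(V,ξ) + A(ξ,A(ξ,V)). The terms quadratic in A cancel, and moving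
arguments by skewness turns LC minus SB into ⟨(∇_ξ A)(V,W),ξ⟩ + ⟨A(V̇,W),ξ⟩ + ⟨A(V,Ẇ),ξ⟩. Because ξ
is parallel for ∇^LC, this is F'.

The computation is carried out in a chart, where `index_identity` is its purely algebraic core. The
remaining work is to show that bracket, connection, curvature, torsion, dω and derivative along a
curve have their classical coordinate expressions (`coordL_curvature`, `coordL_torsion`,
`coordL_covDerivAlong`, `HermitianStructure.extDerivForm_fundamentalForm`), and that the Christoffel
symbols and A are smooth there. -/

namespace HermitianGeometry

noncomputable section

/-! ### Vector fields and Lie brackets in a chart -/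

section Coordinates

variable {E : Type*} [NormedAddCommGroup E] [NormedSpace ℝ E]
  {M : Type*} [TopologicalSpace M] [ChartedSpace E M] {x₀ y : M}

theorem extChartAt_symm_mem {p : E} (hp : p ∈ (extChartAt 𝓘(ℝ, E) x₀).target) :
    (extChartAt 𝓘(ℝ, E) x₀).symm p ∈ (chartAt E x₀).source := by
  simpa using (extChartAt 𝓘(ℝ, E) x₀).map_target hp

theorem extChartAt_mem (hy : y ∈ (chartAt E x₀).source) :
    extChartAt 𝓘(ℝ, E) x₀ y ∈ (extChartAt 𝓘(ℝ, E) x₀).target :=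
  (extChartAt 𝓘(ℝ, E) x₀).map_source (by simpa using hy)

theorem extChartAt_symm_extChartAt (hy : y ∈ (chartAt E x₀).source) :
    (extChartAt 𝓘(ℝ, E) x₀).symm (extChartAt 𝓘(ℝ, E) x₀ y) = y :=
  (extChartAt 𝓘(ℝ, E) x₀).left_inv (by simpa using hy)

theorem target_mem_nhds {p : E} (hp : p ∈ (extChartAt 𝓘(ℝ, E) x₀).target) :
    (extChartAt 𝓘(ℝ, E) x₀).target ∈ 𝓝 p :=
  (isOpen_extChartAt_target x₀).mem_nhds hp

variable [IsManifold 𝓘(ℝ, E) ∞ M]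

/-- The components of a tangent vector at `y` in the chart at `x₀`. -/
def coordL (x₀ y : M) : TangentSpace 𝓘(ℝ, E) y →L[ℝ] E :=
  (trivializationAt E (TangentSpace 𝓘(ℝ, E) : M → Type _) x₀).continuousLinearMapAt ℝ y

/-- The tangent vector at `y` with given components in the chart at `x₀`. -/
def coordSymm (x₀ y : M) : E →L[ℝ] TangentSpace 𝓘(ℝ, E) y :=
  (trivializationAt E (TangentSpace 𝓘(ℝ, E) : M → Type _) x₀).symmL ℝ y

/-- The coordinate expression of a vector field in the chart at `x₀`. -/
def rep (x₀ : M) (X : Π y : M, TangentSpace 𝓘(ℝ, E) y) (p : E) : E :=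
  coordL x₀ ((extChartAt 𝓘(ℝ, E) x₀).symm p) (X ((extChartAt 𝓘(ℝ, E) x₀).symm p))

theorem coordL_coordSymm (hy : y ∈ (chartAt E x₀).source) (w : E) :
    coordL x₀ y (coordSymm x₀ y w) = w :=
  Trivialization.continuousLinearMapAt_symmL _ (by simpa using hy) w

theorem coordSymm_coordL (hy : y ∈ (chartAt E x₀).source) (w : TangentSpace 𝓘(ℝ, E) y) :
    coordSymm x₀ y (coordL x₀ y w) = w :=
  Trivialization.symmL_continuousLinearMapAt _ (by simpa using hy) w

theorem coordL_eq (hy : y ∈ (chartAt E x₀).source) (v : TangentSpace 𝓘(ℝ, E) y) :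
    coordL x₀ y v = (trivializationAt E (TangentSpace 𝓘(ℝ, E) : M → Type _) x₀ ⟨y, v⟩).2 := by
  have : y ∈ (trivializationAt E (TangentSpace 𝓘(ℝ, E) : M → Type _) x₀).baseSet := by
    simpa using hy
  rw [coordL, Trivialization.continuousLinearMapAt_apply, Trivialization.linearMapAt_apply,
    if_pos this]

theorem coordSymm_eq (hy : y ∈ (chartAt E x₀).source) (w : E) :
    coordSymm x₀ y w = (trivializationAt E (TangentSpace 𝓘(ℝ, E) : M → Type _) x₀).symm y w :=
  Trivialization.symmL_apply _ (by simpa using hy) w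

theorem coordL_eq_mfderiv (hy : y ∈ (chartAt E x₀).source) :
    coordL x₀ y = mfderiv 𝓘(ℝ, E) 𝓘(ℝ, E) (extChartAt 𝓘(ℝ, E) x₀) y :=
  TangentBundle.continuousLinearMapAt_trivializationAt hy

/-- By the chain rule the derivative of the inverse chart is a right inverse of the derivative of
the chart, which is `coordL`; applying `coordSymm` identifies it. -/
theorem coordSymm_eq_mfderiv {p : E} (hp : p ∈ (extChartAt 𝓘(ℝ, E) x₀).target) :
    coordSymm (E := E) x₀ ((extChartAt 𝓘(ℝ, E) x₀).symm p)
      = mfderiv 𝓘(ℝ, E) 𝓘(ℝ, E) (extChartAt 𝓘(ℝ, E) x₀).symm p := by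
  have hs := extChartAt_symm_mem hp
  have h := mfderiv_extChartAt_comp_mfderivWithin_extChartAt_symm (I := 𝓘(ℝ, E)) hp
  rw [modelWithCornersSelf_coe, range_id, mfderivWithin_univ] at h
  ext w
  have hw : coordL x₀ _ (mfderiv 𝓘(ℝ, E) 𝓘(ℝ, E) (extChartAt 𝓘(ℝ, E) x₀).symm p w) = w := by
    rw [coordL_eq_mfderiv hs]
    exact congr($h w)
  exact (congrArg (coordSymm x₀ _) hw).symm.trans (coordSymm_coordL hs _)

theorem mlieBracket_eq_lieBracket (A B : E → E) (p : E) :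
    mlieBracket 𝓘(ℝ, E) A B p = lieBracket ℝ A B p :=
  (congrFun (mlieBracketWithin_eq_lieBracketWithin (V := A) (W := B) (s := univ)) p).trans
    (congrFun lieBracketWithin_univ p)

/-- The extensions used to define curvature and the derivative along a curve are thus coordinate
frame fields, but only over the chart domain. -/
theorem extend_eq (u : TangentSpace 𝓘(ℝ, E) x₀) (hy : y ∈ (chartAt E x₀).source) :
    extend E u y = coordSymm x₀ y (coordL x₀ x₀ u) := by
  rw [coordSymm_eq hy, coordL_eq (mem_chart_source E x₀)]
  rfl

theorem contMDiffAt_extChartAt_symm_of_mem {p : E} (hp : p ∈ (extChartAt 𝓘(ℝ, E) x₀).target) :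
    ContMDiffAt 𝓘(ℝ, E) 𝓘(ℝ, E) ∞ (extChartAt 𝓘(ℝ, E) x₀).symm p :=
  (contMDiffOn_extChartAt_symm x₀).contMDiffAt (target_mem_nhds hp)

theorem rep_extChartAt (hy : y ∈ (chartAt E x₀).source) (X : Π y : M, TangentSpace 𝓘(ℝ, E) y) :
    rep x₀ X (extChartAt 𝓘(ℝ, E) x₀ y) = coordL x₀ y (X y) := by
  rw [rep, extChartAt_symm_extChartAt hy]

theorem contMDiffAt_coordSymm (hy : y ∈ (chartAt E x₀).source) (w : E) :
    CMDiffAt ∞ (T% (fun z : M ↦ coordSymm x₀ z w)) y := by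
  have hb : y ∈ (trivializationAt E (TangentSpace 𝓘(ℝ, E) : M → Type _) x₀).baseSet := by
    simpa using hy
  rw [Trivialization.contMDiffAt_section_iff _ hb]
  refine (contMDiffAt_const (c := w)).congr_of_eventuallyEq ?_
  filter_upwards [(chartAt E x₀).open_source.mem_nhds hy] with z hz
  rw [← coordL_eq hz, coordL_coordSymm hz]

theorem mdifferentiableAt_coordSymm (hy : y ∈ (chartAt E x₀).source) (w : E) :
    MDiffAt (T% (fun z : M ↦ coordSymm x₀ z w)) y :=
  (contMDiffAt_coordSymm hy w).mdifferentiableAt (by simp)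

theorem mdifferentiableAt_coordL {X : Π y : M, TangentSpace 𝓘(ℝ, E) y}
    (hy : y ∈ (chartAt E x₀).source) (hX : MDiffAt (T% X) y) :
    MDiffAt (fun z : M ↦ coordL x₀ z (X z)) y := by
  have hb : y ∈ (trivializationAt E (TangentSpace 𝓘(ℝ, E) : M → Type _) x₀).baseSet := by
    simpa using hy
  rw [Trivialization.mdifferentiableAt_section_iff 𝓘(ℝ, E) _ _ hb] at hX
  refine hX.congr_of_eventuallyEq ?_
  filter_upwards [(chartAt E x₀).open_source.mem_nhds hy] with z hz
  rw [coordL_eq hz]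

theorem contMDiffAt_coordL {X : Π y : M, TangentSpace 𝓘(ℝ, E) y}
    (hy : y ∈ (chartAt E x₀).source) (hX : CMDiffAt ∞ (T% X) y) :
    ContMDiffAt 𝓘(ℝ, E) 𝓘(ℝ, E) ∞ (fun z : M ↦ coordL x₀ z (X z)) y := by
  have hb : y ∈ (trivializationAt E (TangentSpace 𝓘(ℝ, E) : M → Type _) x₀).baseSet := by
    simpa using hy
  rw [Trivialization.contMDiffAt_section_iff _ hb] at hX
  refine hX.congr_of_eventuallyEq ?_
  filter_upwards [(chartAt E x₀).open_source.mem_nhds hy] with z hz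
  rw [coordL_eq hz]

variable {F : Type*} [NormedAddCommGroup F] [NormedSpace ℝ F]

theorem contDiffAt_comp_symm {f : M → F} {p : E} (hp : p ∈ (extChartAt 𝓘(ℝ, E) x₀).target)
    (hf : ContMDiffAt 𝓘(ℝ, E) 𝓘(ℝ, F) ∞ f ((extChartAt 𝓘(ℝ, E) x₀).symm p)) :
    ContDiffAt ℝ ∞ (fun q ↦ f ((extChartAt 𝓘(ℝ, E) x₀).symm q)) p :=
  (hf.comp p (contMDiffAt_extChartAt_symm_of_mem hp)).contDiffAt

theorem differentiableAt_comp_symm {f : M → F} {p : E} (hp : p ∈ (extChartAt 𝓘(ℝ, E) x₀).target)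
    (hf : MDifferentiableAt 𝓘(ℝ, E) 𝓘(ℝ, F) f ((extChartAt 𝓘(ℝ, E) x₀).symm p)) :
    DifferentiableAt ℝ (fun q ↦ f ((extChartAt 𝓘(ℝ, E) x₀).symm q)) p :=
  (hf.comp p ((contMDiffAt_extChartAt_symm_of_mem hp).mdifferentiableAt
    (by simp))).differentiableAt

/-- The differential of a function in the chart at `x₀`. -/
theorem mvfderiv_eq_fderiv {f : M → F} (hy : y ∈ (chartAt E x₀).source)
    (hf : MDifferentiableAt 𝓘(ℝ, E) 𝓘(ℝ, F) f y) (v : TangentSpace 𝓘(ℝ, E) y) :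
    mvfderiv 𝓘(ℝ, E) f y v
      = fderiv ℝ (fun q ↦ f ((extChartAt 𝓘(ℝ, E) x₀).symm q)) (extChartAt 𝓘(ℝ, E) x₀ y)
          (coordL x₀ y v) := by
  have hp := extChartAt_mem (E := E) hy
  have hd : DifferentiableAt ℝ (fun q ↦ f ((extChartAt 𝓘(ℝ, E) x₀).symm q))
      (extChartAt 𝓘(ℝ, E) x₀ y) :=
    differentiableAt_comp_symm hp (by rwa [extChartAt_symm_extChartAt hy])
  have h1 : mfderiv 𝓘(ℝ, E) 𝓘(ℝ, F) f y = mfderiv 𝓘(ℝ, E) 𝓘(ℝ, F)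
      ((fun q ↦ f ((extChartAt 𝓘(ℝ, E) x₀).symm q)) ∘ (extChartAt 𝓘(ℝ, E) x₀)) y := by
    refine Filter.EventuallyEq.mfderiv_eq ?_
    filter_upwards [(chartAt E x₀).open_source.mem_nhds hy] with z hz
    simp only [Function.comp, extChartAt_symm_extChartAt hz]
  rw [mfderiv_comp y hd.mdifferentiableAt (mdifferentiableAt_extChartAt hy),
    mfderiv_eq_fderiv] at h1
  rw [coordL_eq_mfderiv hy, mvfderiv]
  exact congr($h1 v)

theorem contDiffAt_rep {X : Π y : M, TangentSpace 𝓘(ℝ, E) y}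
    (hy : y ∈ (chartAt E x₀).source) (hX : CMDiffAt ∞ (T% X) y) :
    ContDiffAt ℝ ∞ (rep x₀ X) (extChartAt 𝓘(ℝ, E) x₀ y) :=
  contDiffAt_comp_symm (f := fun z : M ↦ coordL x₀ z (X z)) (extChartAt_mem hy)
    (by rw [extChartAt_symm_extChartAt hy]; exact contMDiffAt_coordL hy hX)

theorem mdifferentiableAt_of_rep {X : Π y : M, TangentSpace 𝓘(ℝ, E) y}
    (hy : y ∈ (chartAt E x₀).source)
    (hX : DifferentiableAt ℝ (rep x₀ X) (extChartAt 𝓘(ℝ, E) x₀ y)) :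
    MDiffAt (T% X) y := by
  have hb : y ∈ (trivializationAt E (TangentSpace 𝓘(ℝ, E) : M → Type _) x₀).baseSet := by
    simpa using hy
  rw [Trivialization.mdifferentiableAt_section_iff 𝓘(ℝ, E) _ _ hb]
  refine (MDifferentiableAt.comp y hX.mdifferentiableAt
    (mdifferentiableAt_extChartAt hy)).congr_of_eventuallyEq ?_
  filter_upwards [(chartAt E x₀).open_source.mem_nhds hy] with z hz
  rw [Function.comp, rep_extChartAt hz, coordL_eq hz]

variable [FiniteDimensional ℝ E]

/-- The Lie bracket in the chart at `x₀`. -/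
theorem coordL_mlieBracket {X Y : Π y : M, TangentSpace 𝓘(ℝ, E) y}
    (hy : y ∈ (chartAt E x₀).source) (hX : MDiffAt (T% X) y) (hY : MDiffAt (T% Y) y) :
    coordL x₀ y (mlieBracket 𝓘(ℝ, E) X Y y)
      = fderiv ℝ (rep x₀ Y) (extChartAt 𝓘(ℝ, E) x₀ y) (coordL x₀ y (X y))
        - fderiv ℝ (rep x₀ X) (extChartAt 𝓘(ℝ, E) x₀ y) (coordL x₀ y (Y y)) := by
  have : CompleteSpace E := FiniteDimensional.complete ℝ E
  have hp := extChartAt_mem (E := E) hy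
  have h2 : IsManifold 𝓘(ℝ, E) (minSmoothness ℝ 2) M := by
    simp only [minSmoothness_of_isRCLikeNormedField]; infer_instance
  have h2' : IsManifold 𝓘(ℝ, E) (minSmoothness ℝ 2) E := by infer_instance
  -- Pulling back along the inverse chart produces the coordinate representative, so naturality of
  -- the bracket reduces the claim to the bracket on the vector space `E`.
  have hpull : ∀ Z : Π y : M, TangentSpace 𝓘(ℝ, E) y, ∀ q ∈ (extChartAt 𝓘(ℝ, E) x₀).target,
      mpullback 𝓘(ℝ, E) 𝓘(ℝ, E) (extChartAt 𝓘(ℝ, E) x₀).symm Z q = rep x₀ Z q := by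
    intro Z q hq
    have hs := extChartAt_symm_mem hq
    rw [mpullback_apply, ← coordSymm_eq_mfderiv hq, rep]
    have h4 : (coordSymm x₀ ((extChartAt 𝓘(ℝ, E) x₀).symm q)).inverse
        = coordL x₀ ((extChartAt 𝓘(ℝ, E) x₀).symm q) :=
      ContinuousLinearMap.inverse_eq (by ext w; exact coordSymm_coordL hs w)
        (by ext w; exact coordL_coordSymm hs w)
    exact congr($h4 _)
  have key := mpullback_mlieBracket (I := 𝓘(ℝ, E)) (I' := 𝓘(ℝ, E)) (n := ∞)
    (f := (extChartAt 𝓘(ℝ, E) x₀).symm) (V := X) (W := Y) (x₀ := extChartAt 𝓘(ℝ, E) x₀ y)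
    (by rwa [extChartAt_symm_extChartAt hy]) (by rwa [extChartAt_symm_extChartAt hy])
    (contMDiffAt_extChartAt_symm_of_mem hp) (by simpa using ENat.LEInfty.out)
  rw [hpull _ _ hp, rep_extChartAt hy] at key
  rw [key]
  refine (mlieBracket_eq_lieBracket _ _ _).trans ?_
  refine (Filter.EventuallyEq.lieBracket_vectorField_eq (V := rep x₀ X) (W := rep x₀ Y)
    (Filter.eventually_of_mem (target_mem_nhds hp) (hpull X))
    (Filter.eventually_of_mem (target_mem_nhds hp) (hpull Y))).trans ?_
  rw [lieBracket, rep_extChartAt hy, rep_extChartAt hy]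

end Coordinates

/-! ### Christoffel symbols, curvature and torsion in a chart -/

section Christoffel

variable {E : Type*} [NormedAddCommGroup E] [NormedSpace ℝ E]
  {M : Type*} [TopologicalSpace M] [ChartedSpace E M] [IsManifold 𝓘(ℝ, E) ∞ M]
  (D : CovariantDerivative 𝓘(ℝ, E) E (fun x : M ↦ TangentSpace 𝓘(ℝ, E) x)) {x₀ y : M}

/-- Both D and componentwise differentiation obey the same Leibniz rule, so the df terms cancel in
the difference, which therefore depends only on the value of the field at the point. -/
theorem covariantDerivative_sub_tensorialAt (hy : y ∈ (chartAt E x₀).source)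
    (v : TangentSpace 𝓘(ℝ, E) y) :
    TensorialAt 𝓘(ℝ, E) E (fun X : Π z : M, TangentSpace 𝓘(ℝ, E) z ↦
      D X y v - coordSymm x₀ y (mvfderiv 𝓘(ℝ, E) (fun z ↦ coordL x₀ z (X z)) y v)) y where
  smul {f X} hf hX := by
    have h := mvfderiv_fun_smul hf (mdifferentiableAt_coordL hy hX)
    simp only [Pi.smul_apply', map_smul]
    rw [D.isCovariantDerivativeOn.leibniz hX hf (mem_univ y), h]
    simp [coordSymm_coordL hy]
    module
  add {X X'} hX hX' := by
    have h := mvfderiv_fun_add (mdifferentiableAt_coordL hy hX) (mdifferentiableAt_coordL hy hX')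
    simp only [Pi.add_apply, map_add]
    rw [D.isCovariantDerivativeOn.add hX hX' (mem_univ y), h]
    simp
    abel

variable [FiniteDimensional ℝ E]

theorem covariantDerivative_eq {X : Π z : M, TangentSpace 𝓘(ℝ, E) z}
    (hy : y ∈ (chartAt E x₀).source) (hX : MDiffAt (T% X) y) (v : TangentSpace 𝓘(ℝ, E) y) :
    D X y v = D (fun z ↦ coordSymm x₀ z (coordL x₀ y (X y))) y v
      + coordSymm x₀ y (mvfderiv 𝓘(ℝ, E) (fun z ↦ coordL x₀ z (X z)) y v) := by
  have h := (covariantDerivative_sub_tensorialAt D hy v).pointwise hX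
    (mdifferentiableAt_coordSymm hy (coordL x₀ y (X y))) (coordSymm_coordL hy _).symm
  -- The comparison field has constant components, so its componentwise derivative vanishes and only
  -- its covariant derivative survives.
  have h0 : mvfderiv 𝓘(ℝ, E) (fun z : M ↦ coordL x₀ z (coordSymm x₀ z (coordL x₀ y (X y)))) y
      = 0 := by
    have : (fun z : M ↦ coordL x₀ z (coordSymm x₀ z (coordL x₀ y (X y))))
        =ᶠ[𝓝 y] fun _ ↦ coordL x₀ y (X y) := by
      filter_upwards [(chartAt E x₀).open_source.mem_nhds hy] with z hz
      exact coordL_coordSymm hz _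
    ext w
    rw [mvfderiv_eq_fderiv hy (mdifferentiableAt_const.congr_of_eventuallyEq this)]
    have h2 : (fun q ↦ coordL x₀ ((extChartAt 𝓘(ℝ, E) x₀).symm q)
        (coordSymm x₀ ((extChartAt 𝓘(ℝ, E) x₀).symm q) (coordL x₀ y (X y))))
        =ᶠ[𝓝 (extChartAt 𝓘(ℝ, E) x₀ y)] fun _ ↦ coordL x₀ y (X y) := by
      filter_upwards [target_mem_nhds (extChartAt_mem hy)] with q hq
      exact coordL_coordSymm (extChartAt_symm_mem hq) _
    rw [h2.fderiv_eq]
    simp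
  rw [h0] at h
  simp only [_root_.zero_apply, map_zero, sub_zero] at h
  rw [← h]
  abel

open Classical in
/-- The Christoffel symbols of a connection in the chart at `x₀`: `christoffel D x₀ p u w` is the
coordinate expression of `∇_u W` at the point with coordinates `p`, where `W` has constant
components `w`. -/
def christoffel (x₀ : M) (p : E) : E →L[ℝ] E →L[ℝ] E :=
  -- Bilinearity in `w` uses differentiability of the frame fields, which holds over the chart
  -- domain; elsewhere the value is the junk value 0.
  if hp : p ∈ (extChartAt 𝓘(ℝ, E) x₀).target then
    (LinearMap.mk₂ ℝ (fun u w ↦ coordL x₀ ((extChartAt 𝓘(ℝ, E) x₀).symm p)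
      (D (fun z ↦ coordSymm x₀ z w) ((extChartAt 𝓘(ℝ, E) x₀).symm p)
        (coordSymm x₀ ((extChartAt 𝓘(ℝ, E) x₀).symm p) u)))
      (fun u u' w ↦ by simp only [map_add]) (fun c u w ↦ by simp only [map_smul])
      (fun u w w' ↦ by
        have h := D.isCovariantDerivativeOn.add
          (mdifferentiableAt_coordSymm (extChartAt_symm_mem hp) w)
          (mdifferentiableAt_coordSymm (extChartAt_symm_mem hp) w') (mem_univ _)
        have e : ((fun z : M ↦ coordSymm x₀ z w) + fun z : M ↦ coordSymm x₀ z w')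
          = fun z : M ↦ coordSymm x₀ z (w + w') := by ext z; simp
        rw [e] at h
        rw [h, _root_.add_apply, map_add])
      (fun c u w ↦ by
        have h := D.isCovariantDerivativeOn.smul_const c
          (mdifferentiableAt_coordSymm (extChartAt_symm_mem hp) w) (mem_univ _)
        have e : (c • fun z : M ↦ coordSymm x₀ z w) = fun z : M ↦ coordSymm x₀ z (c • w) := by
          ext z; simp
        rw [e] at h
        rw [h, _root_.smul_apply, map_smul])).toContinuousBilinearMap
  else 0

theorem christoffel_apply {p : E} (hp : p ∈ (extChartAt 𝓘(ℝ, E) x₀).target) (u w : E) :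
    christoffel D x₀ p u w = coordL x₀ ((extChartAt 𝓘(ℝ, E) x₀).symm p)
      (D (fun z ↦ coordSymm x₀ z w) ((extChartAt 𝓘(ℝ, E) x₀).symm p)
        (coordSymm x₀ ((extChartAt 𝓘(ℝ, E) x₀).symm p) u)) := by
  rw [christoffel, dif_pos hp]
  rfl

theorem christoffel_extChartAt (hy : y ∈ (chartAt E x₀).source)
    (v : TangentSpace 𝓘(ℝ, E) y) (w : E) :
    christoffel D x₀ (extChartAt 𝓘(ℝ, E) x₀ y) (coordL x₀ y v) w
      = coordL x₀ y (D (fun z ↦ coordSymm x₀ z w) y v) := by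
  rw [christoffel_apply D (extChartAt_mem hy), extChartAt_symm_extChartAt hy, coordSymm_coordL hy]

/-- The covariant derivative in the chart at `x₀`. -/
theorem coordL_covariantDerivative {X : Π z : M, TangentSpace 𝓘(ℝ, E) z}
    (hy : y ∈ (chartAt E x₀).source) (hX : MDiffAt (T% X) y) (v : TangentSpace 𝓘(ℝ, E) y) :
    coordL x₀ y (D X y v) =
      fderiv ℝ (rep x₀ X) (extChartAt 𝓘(ℝ, E) x₀ y) (coordL x₀ y v)
        + christoffel D x₀ (extChartAt 𝓘(ℝ, E) x₀ y) (coordL x₀ y v) (coordL x₀ y (X y)) := by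
  rw [covariantDerivative_eq D hy hX, map_add, christoffel_extChartAt D hy, coordL_coordSymm hy,
    mvfderiv_eq_fderiv hy (mdifferentiableAt_coordL hy hX), add_comm]
  rfl

/-- The coordinate expression of the curvature in terms of the Christoffel symbols. -/
def curvatureCoord (Γ : E → E →L[ℝ] E →L[ℝ] E) (p u v w : E) : E :=
  fderiv ℝ Γ p u v w - fderiv ℝ Γ p v u w + Γ p u (Γ p v w) - Γ p v (Γ p u w)

/-- This is the product rule applied to dZ(Y) + Γ(Y, Z), and it supplies the second covariant
derivatives in the curvature. -/
theorem fderiv_rep_covariantDerivative {Y Z : Π z : M, TangentSpace 𝓘(ℝ, E) z}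
    (hy : y ∈ (chartAt E x₀).source)
    (hΓ : DifferentiableAt ℝ (christoffel D x₀) (extChartAt 𝓘(ℝ, E) x₀ y))
    (hY : CMDiffAt ∞ (T% Y) y) (hZ : CMDiffAt ∞ (T% Z) y) :
    HasFDerivAt (rep x₀ (fun z ↦ D Z z (Y z)))
      ((fderiv ℝ (rep x₀ Z) (extChartAt 𝓘(ℝ, E) x₀ y)).comp
          (fderiv ℝ (rep x₀ Y) (extChartAt 𝓘(ℝ, E) x₀ y))
        + (fderiv ℝ (fderiv ℝ (rep x₀ Z)) (extChartAt 𝓘(ℝ, E) x₀ y)).flip (coordL x₀ y (Y y))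
        + ((christoffel D x₀ (extChartAt 𝓘(ℝ, E) x₀ y) (coordL x₀ y (Y y))).comp
            (fderiv ℝ (rep x₀ Z) (extChartAt 𝓘(ℝ, E) x₀ y))
          + ((christoffel D x₀ (extChartAt 𝓘(ℝ, E) x₀ y)).comp
              (fderiv ℝ (rep x₀ Y) (extChartAt 𝓘(ℝ, E) x₀ y))
            + (fderiv ℝ (christoffel D x₀) (extChartAt 𝓘(ℝ, E) x₀ y)).flip
              (coordL x₀ y (Y y))).flip (coordL x₀ y (Z y))))
      (extChartAt 𝓘(ℝ, E) x₀ y) := by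
  have hp := extChartAt_mem (E := E) hy
  have hZr := contDiffAt_rep hy hZ
  have hZ1 : DifferentiableAt ℝ (fderiv ℝ (rep x₀ Z)) (extChartAt 𝓘(ℝ, E) x₀ y) :=
    (hZr.fderiv_right (m := 1) (by norm_cast)).differentiableAt (by simp)
  have hZ0 := hZr.differentiableAt (by simp)
  have hY0 := (contDiffAt_rep hy hY).differentiableAt (by simp)
  have h1 := hZ1.hasFDerivAt.clm_apply hY0.hasFDerivAt
  have h2 := (hΓ.hasFDerivAt.clm_apply hY0.hasFDerivAt).clm_apply hZ0.hasFDerivAt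
  rw [rep_extChartAt hy] at h1 h2
  rw [rep_extChartAt hy] at h2
  refine (h1.add h2).congr_of_eventuallyEq ?_
  -- The coordinate formula for the covariant derivative must hold on a whole neighbourhood before
  -- it can be differentiated, so `Z` has to be differentiable at nearby points.
  have hev : ∀ᶠ q in 𝓝 (extChartAt 𝓘(ℝ, E) x₀ y),
      CMDiffAt 1 (T% Z) ((extChartAt 𝓘(ℝ, E) x₀).symm q) := by
    have hc : ContinuousAt (extChartAt 𝓘(ℝ, E) x₀).symm (extChartAt 𝓘(ℝ, E) x₀ y) :=
      (contMDiffAt_extChartAt_symm_of_mem hp).continuousAt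
    refine hc.eventually ?_
    rw [extChartAt_symm_extChartAt hy]
    exact (contMDiffAt_iff_contMDiffAt_nhds (by simp)).1 (hZ.of_le (by simp))
  filter_upwards [target_mem_nhds hp, hev] with q hq hZq
  have hs := extChartAt_symm_mem hq
  have h3 := coordL_covariantDerivative D hs (hZq.mdifferentiableAt (by simp))
    (Y ((extChartAt 𝓘(ℝ, E) x₀).symm q))
  rw [(extChartAt 𝓘(ℝ, E) x₀).right_inv hq] at h3
  exact h3

/-- The curvature in the chart at `x₀`. -/
theorem coordL_curvature (hy : y ∈ (chartAt E x₀).source)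
    (hΓ : DifferentiableAt ℝ (christoffel D x₀) (extChartAt 𝓘(ℝ, E) x₀ y))
    (u v w : TangentSpace 𝓘(ℝ, E) y) :
    coordL x₀ y (curvature D y u v w) =
      curvatureCoord (christoffel D x₀) (extChartAt 𝓘(ℝ, E) x₀ y)
        (coordL x₀ y u) (coordL x₀ y v) (coordL x₀ y w) := by
  have hs (a : TangentSpace 𝓘(ℝ, E) y) : CMDiffAt ∞ (T% (extend E a)) y :=
    contMDiffAt_extend 𝓘(ℝ, E) E a
  have hd (a : TangentSpace 𝓘(ℝ, E) y) : MDiffAt (T% (extend E a)) y :=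
    (hs a).mdifferentiableAt (by simp)
  have h1 := fderiv_rep_covariantDerivative D hy hΓ (hs v) (hs w)
  have h2 := fderiv_rep_covariantDerivative D hy hΓ (hs u) (hs w)
  -- The chart at `x₀` need not be the one defining the extensions, so their representatives are not
  -- constant. Their second derivatives cancel by symmetry, their first derivatives against the
  -- bracket term.
  have hsymm : IsSymmSndFDerivAt ℝ (rep x₀ (extend E w)) (extChartAt 𝓘(ℝ, E) x₀ y) :=
    (contDiffAt_rep hy (hs w)).isSymmSndFDerivAt (by simpa using ENat.LEInfty.out)
  rw [curvature]
  simp only [map_sub]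
  rw [coordL_covariantDerivative D hy (mdifferentiableAt_of_rep hy h1.differentiableAt),
    coordL_covariantDerivative D hy (mdifferentiableAt_of_rep hy h2.differentiableAt),
    coordL_covariantDerivative D hy (hd w), coordL_covariantDerivative D hy (hd w),
    coordL_covariantDerivative D hy (hd w),
    coordL_mlieBracket hy (hd u) (hd v), h1.fderiv, h2.fderiv]
  simp only [extend_apply_self, curvatureCoord, _root_.add_apply,
    ContinuousLinearMap.comp_apply, ContinuousLinearMap.flip_apply, map_sub, map_add,
    _root_.sub_apply]
  rw [hsymm.eq (coordL x₀ y u) (coordL x₀ y v)]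
  abel

/-- The torsion in the chart at `x₀`. -/
theorem coordL_torsion (hy : y ∈ (chartAt E x₀).source) (u v : TangentSpace 𝓘(ℝ, E) y) :
    coordL x₀ y (D.torsion y u v) =
      christoffel D x₀ (extChartAt 𝓘(ℝ, E) x₀ y) (coordL x₀ y u) (coordL x₀ y v)
        - christoffel D x₀ (extChartAt 𝓘(ℝ, E) x₀ y) (coordL x₀ y v) (coordL x₀ y u) := by
  have hd (a : TangentSpace 𝓘(ℝ, E) y) : MDiffAt (T% (extend E a)) y :=
    mdifferentiableAt_extend ..
  rw [CovariantDerivative.torsion_apply_eq_extend]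
  simp only [map_sub]
  rw [coordL_covariantDerivative D hy (hd v), coordL_covariantDerivative D hy (hd u),
    coordL_mlieBracket hy (hd u) (hd v)]
  simp only [extend_apply_self]
  abel

end Christoffel

/-- A family of continuous linear maps on a finite-dimensional space is `C^n` at a point if all its
applications are. -/
theorem contDiffAt_clm_of_apply {P E F : Type*} [NormedAddCommGroup P] [NormedSpace ℝ P]
    [NormedAddCommGroup E] [NormedSpace ℝ E] [FiniteDimensional ℝ E]
    [NormedAddCommGroup F] [NormedSpace ℝ F] {n : WithTop ℕ∞} {f : P → E →L[ℝ] F} {p : P}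
    (h : ∀ w, ContDiffAt ℝ n (fun q ↦ f q w) p) : ContDiffAt ℝ n f p := by
  let d := Module.finrank ℝ E
  have hd : d = Module.finrank ℝ (Fin d → ℝ) := (Module.finrank_fin_fun ℝ).symm
  let e₁ := ContinuousLinearEquiv.ofFinrankEq hd
  let e₂ := (e₁.arrowCongr (1 : F ≃L[ℝ] F)).trans (ContinuousLinearEquiv.piRing (Fin d))
  rw [← Function.id_comp f, ← e₂.symm_comp_self]
  exact e₂.symm.contDiff.contDiffAt.comp p (contDiffAt_pi.mpr fun i ↦ h _)

/-! ### Curves and covariant differentiation along them in a chart -/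

section Curves

variable {E : Type*} [NormedAddCommGroup E] [NormedSpace ℝ E]
  {M : Type*} [TopologicalSpace M] [ChartedSpace E M]
  {x₀ : M} {γ : ℝ → M} {a b t : ℝ}

theorem eventually_mem_source (hγ : ContMDiffOn 𝓘(ℝ, ℝ) 𝓘(ℝ, E) ∞ γ (Icc a b))
    (ht : t ∈ Icc a b) (hs : γ t ∈ (chartAt E x₀).source) :
    ∀ᶠ s in 𝓝[Icc a b] t, γ s ∈ (chartAt E x₀).source :=
  (hγ t ht).continuousWithinAt.eventually ((chartAt E x₀).open_source.mem_nhds hs)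

variable [IsManifold 𝓘(ℝ, E) ∞ M]

/-- The coordinate expression of a vector field along a curve. -/
def fieldCoord (x₀ : M) (γ : ℝ → M) (V : Π t : ℝ, TangentSpace 𝓘(ℝ, E) (γ t)) (s : ℝ) : E :=
  coordL x₀ (γ s) (V s)

/-- The coordinate expression of a curve. -/
def curveCoord (x₀ : M) (γ : ℝ → M) (s : ℝ) : E :=
  extChartAt 𝓘(ℝ, E) x₀ (γ s)

theorem contDiffWithinAt_curveCoord (hγ : ContMDiffOn 𝓘(ℝ, ℝ) 𝓘(ℝ, E) ∞ γ (Icc a b))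
    (ht : t ∈ Icc a b) (hs : γ t ∈ (chartAt E x₀).source) :
    ContDiffWithinAt ℝ ∞ (curveCoord (E := E) x₀ γ) (Icc a b) t :=
  ((contMDiffAt_extChartAt' (n := ∞) hs).comp_contMDiffWithinAt t (hγ t ht)).contDiffWithinAt

theorem contDiffWithinAt_fieldCoord {V : Π t : ℝ, TangentSpace 𝓘(ℝ, E) (γ t)}
    (hγ : ContMDiffOn 𝓘(ℝ, ℝ) 𝓘(ℝ, E) ∞ γ (Icc a b)) (hV : IsSmoothAlong γ a b V)
    (ht : t ∈ Icc a b) (hs : γ t ∈ (chartAt E x₀).source) :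
    ContDiffWithinAt ℝ ∞ (fieldCoord x₀ γ V) (Icc a b) t := by
  have h := hV t ht
  have hb : (TotalSpace.mk' E (γ t) (V t) : TangentBundle 𝓘(ℝ, E) M)
      ∈ (trivializationAt E (TangentSpace 𝓘(ℝ, E) : M → Type _) x₀).source := by
    rw [Trivialization.mem_source]; simpa using hs
  rw [ModelWithCorners.tangent, Trivialization.contMDiffWithinAt_iff
    (f := fun s ↦ (TotalSpace.mk' E (γ s) (V s) : TangentBundle 𝓘(ℝ, E) M)) hb] at h
  refine h.2.contDiffWithinAt.congr_of_eventuallyEq ?_ (coordL_eq hs _)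
  filter_upwards [eventually_mem_source hγ ht hs] with s hs'
  exact coordL_eq hs' _

theorem coordL_velocity (hab : a < b) (hγ : ContMDiffOn 𝓘(ℝ, ℝ) 𝓘(ℝ, E) ∞ γ (Icc a b))
    (ht : t ∈ Icc a b) (hs : γ t ∈ (chartAt E x₀).source) :
    coordL x₀ (γ t) (velocity γ a b t) = derivWithin (curveCoord (E := E) x₀ γ) (Icc a b) t := by
  have hu : UniqueMDiffWithinAt 𝓘(ℝ, ℝ) (Icc a b) t :=
    (uniqueDiffOn_Icc hab t ht).uniqueMDiffWithinAt
  have h := mfderiv_comp_mfderivWithin (I' := 𝓘(ℝ, E)) (I'' := 𝓘(ℝ, E)) t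
    (mdifferentiableAt_extChartAt hs) ((hγ t ht).mdifferentiableWithinAt (by simp)) hu
  rw [mfderivWithin_eq_fderivWithin] at h
  rw [velocity, coordL_eq_mfderiv hs]
  exact congr($h (1 : ℝ)).symm

variable [FiniteDimensional ℝ E]
  (D : CovariantDerivative 𝓘(ℝ, E) E (fun x : M ↦ TangentSpace 𝓘(ℝ, E) x))

/-- The covariant derivative along a curve in the chart at `x₀`. -/
theorem coordL_covDerivAlong (hab : a < b) {V : Π t : ℝ, TangentSpace 𝓘(ℝ, E) (γ t)}
    (hγ : ContMDiffOn 𝓘(ℝ, ℝ) 𝓘(ℝ, E) ∞ γ (Icc a b))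
    (ht : t ∈ Icc a b) (hs : γ t ∈ (chartAt E x₀).source)
    (hV : DifferentiableWithinAt ℝ (fieldCoord x₀ γ V) (Icc a b) t) :
    coordL x₀ (γ t) (covDerivAlong D γ a b V t)
      = derivWithin (fieldCoord x₀ γ V) (Icc a b) t
        + christoffel D x₀ (curveCoord (E := E) x₀ γ t)
          (derivWithin (curveCoord (E := E) x₀ γ) (Icc a b) t) (fieldCoord x₀ γ V t) := by
  have hs₁ := mem_chart_source E (γ t)
  have hp := extChartAt_mem (E := E) hs
  let X : Π z : M, TangentSpace 𝓘(ℝ, E) z := fun z ↦ coordSymm x₀ z (fieldCoord x₀ γ V t)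
  have hXt : X (γ t) = V t := coordSymm_coordL hs _
  have hX : MDiffAt (T% X) (γ t) := mdifferentiableAt_coordSymm hs _
  -- `C` is the change of frame from the chart at `x₀` to the chart at `γ t`, in which
  -- `covDerivAlong` is defined.
  let C : E → E →L[ℝ] E := fun q ↦ (coordL (γ t) ((extChartAt 𝓘(ℝ, E) x₀).symm q)).comp
    (coordSymm x₀ ((extChartAt 𝓘(ℝ, E) x₀).symm q))
  have hC : DifferentiableAt ℝ C (curveCoord (E := E) x₀ γ t) := by
    refine (contDiffAt_clm_of_apply (n := ∞) fun w ↦ ?_).differentiableAt (by simp)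
    refine contDiffAt_comp_symm (f := fun z : M ↦ coordL (γ t) z (coordSymm x₀ z w)) hp ?_
    rw [curveCoord, extChartAt_symm_extChartAt hs]
    exact contMDiffAt_coordL hs₁ (contMDiffAt_coordSymm hs w)
  have hx := ((contDiffWithinAt_curveCoord hγ ht hs).differentiableWithinAt
    (by simp)).hasDerivWithinAt
  have h1 := (hC.hasFDerivAt.comp_hasDerivWithinAt t hx).clm_apply hV.hasDerivWithinAt
  have heq : (fun s ↦ (trivializationAt E (TangentSpace 𝓘(ℝ, E) : M → Type _) (γ t)
        (TotalSpace.mk' E (γ s) (V s))).2) =ᶠ[𝓝[Icc a b] t]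
      fun s ↦ (C ∘ curveCoord x₀ γ) s (fieldCoord x₀ γ V s) := by
    filter_upwards [eventually_mem_source hγ ht hs, eventually_mem_source hγ ht hs₁] with s h3 h4
    simp only [Function.comp, C, curveCoord, ContinuousLinearMap.comp_apply, fieldCoord]
    rw [extChartAt_symm_extChartAt h3, coordSymm_coordL h3, coordL_eq h4]
  have h2 := h1.congr_of_eventuallyEq_of_mem heq ht
  have hext : D (extend E (V t)) (γ t)
      = D (fun z ↦ coordSymm (γ t) z (coordL (γ t) (γ t) (V t))) (γ t) := by
    refine D.isCovariantDerivativeOn.congr_of_eventuallyEq (s := univ)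
      (mdifferentiableAt_extend ..) (mdifferentiableAt_coordSymm hs₁ _) Filter.univ_mem ?_
    filter_upwards [(chartAt E (γ t)).open_source.mem_nhds hs₁] with z hz
    exact extend_eq (V t) hz
  -- Passing from the frame at `γ t` to the one at `x₀` costs a term in the derivative of `C`; the
  -- same term occurs when the components C(u) of `V` are differentiated, and the two cancel.
  have h5 := covariantDerivative_eq D hs₁ hX (velocity γ a b t)
  rw [hXt, ← hext, mvfderiv_eq_fderiv hs (mdifferentiableAt_coordL hs₁ hX),
    coordL_velocity hab hγ ht hs] at h5
  have h6 : fderiv ℝ (fun q ↦ coordL (γ t) ((extChartAt 𝓘(ℝ, E) x₀).symm q)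
      (X ((extChartAt 𝓘(ℝ, E) x₀).symm q))) (extChartAt 𝓘(ℝ, E) x₀ (γ t))
        = (fderiv ℝ C (curveCoord (E := E) x₀ γ t)).flip (fieldCoord x₀ γ V t) := by
    have := hC.hasFDerivAt.clm_apply
      (hasFDerivAt_const (fieldCoord x₀ γ V t) (curveCoord (E := E) x₀ γ t))
    simp only [ContinuousLinearMap.comp_zero, zero_add] at this
    exact this.fderiv
  rw [h6] at h5
  have hCt (w : E) : coordSymm (γ t) (γ t) (C (curveCoord (E := E) x₀ γ t) w)
      = coordSymm x₀ (γ t) w := by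
    simp only [C, curveCoord, ContinuousLinearMap.comp_apply]
    rw [extChartAt_symm_extChartAt hs, coordSymm_coordL hs₁]
  have h7 := christoffel_extChartAt D hs (velocity γ a b t) (fieldCoord x₀ γ V t)
  rw [coordL_velocity hab hγ ht hs] at h7
  rw [covDerivAlong, ← coordSymm_eq hs₁, h2.derivWithin (uniqueDiffOn_Icc hab t ht), map_add,
    map_add, map_add, Function.comp_apply, hCt, coordL_coordSymm hs]
  have h8 := congrArg (coordL x₀ (γ t)) h5
  rw [map_add] at h8
  change _ = _ + christoffel D x₀ (extChartAt 𝓘(ℝ, E) x₀ (γ t)) _ _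
  rw [h7]
  refine Eq.trans ?_ (congrArg (_ + ·) h8.symm)
  simp only [ContinuousLinearMap.flip_apply]
  abel

end Curves

set_option synthInstance.maxHeartbeats 400000 in
theorem contDiffAt_fderiv_apply {E F : Type*} [NormedAddCommGroup E] [NormedSpace ℝ E]
    [NormedAddCommGroup F] [NormedSpace ℝ F] {f : E → E →L[ℝ] E →L[ℝ] F} {p : E}
    (hf : ContDiffAt ℝ ∞ f p) {u v w : E → E} (hu : ContDiffAt ℝ ∞ u p) (hv : ContDiffAt ℝ ∞ v p)
    (hw : ContDiffAt ℝ ∞ w p) :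
    ContDiffAt ℝ ∞ (fun q ↦ fderiv ℝ f q (u q) (v q) (w q)) p := by
  have h1 := hf.fderiv_right (m := ∞) (by simp)
  have h2 := h1.clm_apply hu
  have h3 := h2.clm_apply hv
  exact h3.clm_apply hw

/-! ### The metric and the Levi-Civita symbols in a chart -/

section Metric

variable {E : Type*} [NormedAddCommGroup E] [NormedSpace ℝ E]
  {M : Type*} [TopologicalSpace M] [ChartedSpace E M] [IsManifold 𝓘(ℝ, E) ∞ M]
  [RiemannianBundle (fun x : M ↦ TangentSpace 𝓘(ℝ, E) x)] {x₀ y : M} {p : E}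

theorem contMDiffAt_inner
    [IsContMDiffRiemannianBundle 𝓘(ℝ, E) ∞ E (fun x : M ↦ TangentSpace 𝓘(ℝ, E) x)]
    {X Y : Π x : M, TangentSpace 𝓘(ℝ, E) x}
    (hX : CMDiffAt ∞ (T% X) y) (hY : CMDiffAt ∞ (T% Y) y) :
    ContMDiffAt 𝓘(ℝ, E) 𝓘(ℝ, ℝ) ∞ (fun z ↦ (inner ℝ (X z) (Y z) : ℝ)) y :=
  ContMDiffAt.inner_bundle (E := fun x : M ↦ TangentSpace 𝓘(ℝ, E) x) (F := E)
    (b := id) (v := X) (w := Y) hX hY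

variable [FiniteDimensional ℝ E]

/-- The coordinate expression of the metric in the chart at `x₀`. -/
def metricCoord (x₀ : M) (p : E) : E →L[ℝ] E →L[ℝ] ℝ :=
  (LinearMap.mk₂ ℝ (fun u w ↦ (inner ℝ (coordSymm x₀ ((extChartAt 𝓘(ℝ, E) x₀).symm p) u)
    (coordSymm x₀ ((extChartAt 𝓘(ℝ, E) x₀).symm p) w) : ℝ))
    (fun u u' w ↦ by simp only [map_add, inner_add_left])
    (fun c u w ↦ by simp only [map_smul, real_inner_smul_left, smul_eq_mul])
    (fun u w w' ↦ by simp only [map_add, inner_add_right])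
    (fun c u w ↦ by simp only [map_smul, real_inner_smul_right, smul_eq_mul])
    ).toContinuousBilinearMap

theorem metricCoord_apply (x₀ : M) (p u w : E) :
    metricCoord x₀ p u w = inner ℝ (coordSymm x₀ ((extChartAt 𝓘(ℝ, E) x₀).symm p) u)
      (coordSymm x₀ ((extChartAt 𝓘(ℝ, E) x₀).symm p) w) := rfl

theorem metricCoord_coordL (hy : y ∈ (chartAt E x₀).source) (u w : TangentSpace 𝓘(ℝ, E) y) :
    metricCoord x₀ (extChartAt 𝓘(ℝ, E) x₀ y) (coordL x₀ y u) (coordL x₀ y w) = inner ℝ u w := by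
  rw [metricCoord_apply, extChartAt_symm_extChartAt hy, coordSymm_coordL hy, coordSymm_coordL hy]

theorem metricCoord_comm (x₀ : M) (p u w : E) :
    metricCoord x₀ p u w = metricCoord x₀ p w u := by
  rw [metricCoord_apply, metricCoord_apply, real_inner_comm]

theorem metricCoord_injective (hp : p ∈ (extChartAt 𝓘(ℝ, E) x₀).target) :
    Function.Injective (metricCoord x₀ p) := by
  rw [injective_iff_map_eq_zero]
  intro u hu
  have h : metricCoord x₀ p u u = 0 := by rw [hu]; rfl
  rw [metricCoord_apply, inner_self_eq_zero] at h
  have h2 := coordL_coordSymm (extChartAt_symm_mem hp) u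
  rw [h, map_zero] at h2
  exact h2.symm

variable [IsContMDiffRiemannianBundle 𝓘(ℝ, E) ∞ E (fun x : M ↦ TangentSpace 𝓘(ℝ, E) x)]

theorem contDiffAt_metricCoord (hp : p ∈ (extChartAt 𝓘(ℝ, E) x₀).target) :
    ContDiffAt ℝ ∞ (metricCoord x₀) p := by
  refine contDiffAt_clm_of_apply fun u ↦ contDiffAt_clm_of_apply fun w ↦ ?_
  have hs := extChartAt_symm_mem hp
  exact contDiffAt_comp_symm
    (f := fun z : M ↦ (inner ℝ (coordSymm x₀ z u) (coordSymm x₀ z w) : ℝ)) hp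
    (contMDiffAt_inner (contMDiffAt_coordSymm hs u) (contMDiffAt_coordSymm hs w))

/-- A bilinear map with values in `E` is smooth if it is smooth after lowering an index. -/
theorem contDiffAt_of_metricCoord (hp : p ∈ (extChartAt 𝓘(ℝ, E) x₀).target)
    {Q : E → E →L[ℝ] E →L[ℝ] E}
    (hQ : ∀ u v w, ContDiffAt ℝ ∞ (fun q ↦ metricCoord x₀ q (Q q u v) w) p) :
    ContDiffAt ℝ ∞ Q p := by
  have : CompleteSpace E := FiniteDimensional.complete ℝ E
  -- Nondegeneracy and equality of dimensions make the metric an isomorphism onto the dual;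
  -- inversion of isomorphisms is smooth, so the index can be raised again smoothly.
  have hequiv : ∀ q ∈ (extChartAt 𝓘(ℝ, E) x₀).target,
      ∃ e : E ≃L[ℝ] (E →L[ℝ] ℝ), (e : E →L[ℝ] E →L[ℝ] ℝ) = metricCoord x₀ q := by
    intro q hq
    refine ⟨(LinearEquiv.ofInjectiveOfFinrankEq
      (metricCoord x₀ q : E →ₗ[ℝ] (E →L[ℝ] ℝ)) (metricCoord_injective hq)
      ?_).toContinuousLinearEquiv,
      by ext u w; rfl⟩
    rw [← LinearMap.toContinuousLinearMap.finrank_eq (R := ℝ) (M := E →ₗ[ℝ] ℝ)]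
    exact (Subspace.dual_finrank_eq (K := ℝ) (V := E)).symm
  refine contDiffAt_clm_of_apply fun u ↦ contDiffAt_clm_of_apply fun v ↦ ?_
  have h1 : ContDiffAt ℝ ∞ (fun q ↦ metricCoord x₀ q (Q q u v)) p :=
    contDiffAt_clm_of_apply fun w ↦ hQ u v w
  obtain ⟨e, he⟩ := hequiv p hp
  have h2 : ContDiffAt ℝ ∞ ContinuousLinearMap.inverse (metricCoord x₀ p) := by
    rw [← he]
    exact contDiffAt_map_inverse e
  refine ((h2.comp p (contDiffAt_metricCoord hp)).clm_apply h1).congr_of_eventuallyEq ?_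
  filter_upwards [target_mem_nhds hp] with q hq
  obtain ⟨e', he'⟩ := hequiv q hq
  simp [← he']

/-- The antisymmetric part of the Christoffel symbols is the torsion, which vanishes. -/
theorem christoffel_leviCivita_comm (hp : p ∈ (extChartAt 𝓘(ℝ, E) x₀).target) (u w : E) :
    christoffel (leviCivita E M) x₀ p u w = christoffel (leviCivita E M) x₀ p w u := by
  have hs := extChartAt_symm_mem hp
  have h := coordL_torsion (leviCivita E M) hs
    (coordSymm x₀ _ u) (coordSymm x₀ _ w)
  rw [leviCivita_torsion, coordL_coordSymm hs, coordL_coordSymm hs,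
    (extChartAt 𝓘(ℝ, E) x₀).right_inv hp] at h
  exact sub_eq_zero.1 (h.symm.trans (map_zero _))

/-- This is metric compatibility evaluated on frame fields. -/
theorem fderiv_metricCoord (hp : p ∈ (extChartAt 𝓘(ℝ, E) x₀).target) (z u w : E) :
    fderiv ℝ (metricCoord x₀) p z u w
      = metricCoord x₀ p (christoffel (leviCivita E M) x₀ p z u) w
        + metricCoord x₀ p u (christoffel (leviCivita E M) x₀ p z w) := by
  have hs := extChartAt_symm_mem hp
  have h := leviCivita_metric (mdifferentiableAt_coordSymm hs z)
    (mdifferentiableAt_coordSymm hs u) (mdifferentiableAt_coordSymm hs w)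
  rw [mvfderiv_eq_fderiv hs (mdiffAt_inner (mdifferentiableAt_coordSymm hs u)
    (mdifferentiableAt_coordSymm hs w)), coordL_coordSymm hs,
    (extChartAt 𝓘(ℝ, E) x₀).right_inv hp] at h
  have hG := ((contDiffAt_metricCoord (x₀ := x₀) hp).differentiableAt (by simp)).hasFDerivAt
  have h2 := (hG.clm_apply (hasFDerivAt_const u p)).clm_apply (hasFDerivAt_const w p)
  simp only [ContinuousLinearMap.comp_zero, zero_add] at h2
  have h3 := h2.fderiv
  rw [christoffel_apply _ hp, christoffel_apply _ hp, metricCoord_apply, metricCoord_apply,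
    coordSymm_coordL hs, coordSymm_coordL hs, ← h]
  exact congr($h3 z).symm

theorem contDiffAt_christoffel_leviCivita (hp : p ∈ (extChartAt 𝓘(ℝ, E) x₀).target) :
    ContDiffAt ℝ ∞ (christoffel (leviCivita E M) x₀) p := by
  refine contDiffAt_of_metricCoord hp fun u v w ↦ ?_
  have h (z u w : E) : ContDiffAt ℝ ∞ (fun q ↦ fderiv ℝ (metricCoord x₀) q z u w) p :=
    contDiffAt_fderiv_apply (contDiffAt_metricCoord hp) contDiffAt_const contDiffAt_const
      contDiffAt_const
  -- The classical formula G(Γ(u,v),w) = ½(∂_u G(v,w) + ∂_v G(u,w) − ∂_w G(u,v)).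
  refine ((((h u v w).add (h v u w)).sub (h w u v)).const_smul (1 / 2 : ℝ)).congr_of_eventuallyEq ?_
  filter_upwards [target_mem_nhds hp] with q hq
  simp only [smul_eq_mul, fderiv_metricCoord hq]
  rw [christoffel_leviCivita_comm hq v u, christoffel_leviCivita_comm hq w u,
    christoffel_leviCivita_comm hq w v, metricCoord_comm x₀ q v, metricCoord_comm x₀ q u]
  ring

end Metric

/-! ### Exterior derivatives in an arbitrary chart -/

section Forms

variable {E : Type*} [NormedAddCommGroup E] [NormedSpace ℝ E]
  {M : Type*} [TopologicalSpace M] [ChartedSpace E M] [IsManifold 𝓘(ℝ, E) ∞ M]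
  {x₀ y : M} {p : E} {k : ℕ}

/-- The coordinate expression of a differential form in the chart at `x₀`. -/
def formCoord (x₀ : M) (η : Π x : M, TangentSpace 𝓘(ℝ, E) x [⋀^Fin k]→L[ℝ] ℝ) (p : E) :
    E [⋀^Fin k]→L[ℝ] ℝ :=
  (η ((extChartAt 𝓘(ℝ, E) x₀).symm p)).compContinuousLinearMap
    (coordSymm x₀ ((extChartAt 𝓘(ℝ, E) x₀).symm p))

theorem formCoord_extChartAt (η : Π x : M, TangentSpace 𝓘(ℝ, E) x [⋀^Fin k]→L[ℝ] ℝ)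
    (hy : y ∈ (chartAt E x₀).source) :
    formCoord x₀ η (extChartAt 𝓘(ℝ, E) x₀ y)
      = (η y).compContinuousLinearMap (coordSymm x₀ y) := by
  rw [formCoord, extChartAt_symm_extChartAt hy]

/-- The exterior derivative may be computed in any chart. -/
theorem extDerivForm_coordSymm (η : Π x : M, TangentSpace 𝓘(ℝ, E) x [⋀^Fin k]→L[ℝ] ℝ)
    (hy : y ∈ (chartAt E x₀).source)
    (hη : DifferentiableAt ℝ (formCoord y η) (extChartAt 𝓘(ℝ, E) y y)) :
    (extDerivForm η y).compContinuousLinearMap (coordSymm x₀ y)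
      = extDeriv (formCoord x₀ η) (extChartAt 𝓘(ℝ, E) x₀ y) := by
  have hyy := mem_chart_source E y
  -- The exterior derivative at `y` is defined in the preferred chart of `y`. The two coordinate
  -- expressions of the form are related by pullback along this transition map, and `extDeriv`
  -- commutes with pullback.
  let f : E → E := fun q ↦ extChartAt 𝓘(ℝ, E) y ((extChartAt 𝓘(ℝ, E) x₀).symm q)
  have hfy : f (extChartAt 𝓘(ℝ, E) x₀ y) = extChartAt 𝓘(ℝ, E) y y := by
    simp only [f]
    rw [extChartAt_symm_extChartAt hy]
  have hp := extChartAt_mem (E := E) hy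
  have hf : ContDiffAt ℝ ∞ f (extChartAt 𝓘(ℝ, E) x₀ y) := by
    refine contDiffAt_comp_symm (f := extChartAt 𝓘(ℝ, E) y) hp ?_
    rw [extChartAt_symm_extChartAt hy]
    exact contMDiffAt_extChartAt' hyy
  have hdf : ∀ q ∈ (extChartAt 𝓘(ℝ, E) x₀).target,
      (extChartAt 𝓘(ℝ, E) x₀).symm q ∈ (chartAt E y).source → ∀ w,
      fderiv ℝ f q w = coordL y ((extChartAt 𝓘(ℝ, E) x₀).symm q)
        (coordSymm x₀ ((extChartAt 𝓘(ℝ, E) x₀).symm q) w) := by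
    intro q hq hqy w
    rw [coordSymm_eq_mfderiv hq, coordL_eq_mfderiv hqy, ← mfderiv_eq_fderiv]
    have := mfderiv_comp q (I := 𝓘(ℝ, E)) (I' := 𝓘(ℝ, E)) (I'' := 𝓘(ℝ, E))
      (mdifferentiableAt_extChartAt hqy)
      ((contMDiffAt_extChartAt_symm_of_mem hq).mdifferentiableAt (by simp))
    exact congr($this w)
  have h1 : extDerivForm η y
      = (extDeriv (formCoord y η) (extChartAt 𝓘(ℝ, E) y y)).compContinuousLinearMap
        (coordL y y) := by
    have h2 : (fun q : E ↦ (η ((extChartAt 𝓘(ℝ, E) y).symm q)).compContinuousLinearMap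
        (mfderiv 𝓘(ℝ, E) 𝓘(ℝ, E) (extChartAt 𝓘(ℝ, E) y).symm q))
        =ᶠ[𝓝 (extChartAt 𝓘(ℝ, E) y y)] formCoord y η := by
      filter_upwards [target_mem_nhds (extChartAt_mem hyy)] with q hq
      rw [formCoord, coordSymm_eq_mfderiv hq]
    have h3 := h2.extDeriv_eq
    rw [coordL_eq_mfderiv hyy, ← h3]
    rfl
  have h4 : formCoord x₀ η =ᶠ[𝓝 (extChartAt 𝓘(ℝ, E) x₀ y)]
      fun q ↦ (formCoord y η (f q)).compContinuousLinearMap (fderiv ℝ f q) := by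
    have hc : ContinuousAt (extChartAt 𝓘(ℝ, E) x₀).symm (extChartAt 𝓘(ℝ, E) x₀ y) :=
      (contMDiffAt_extChartAt_symm_of_mem hp).continuousAt
    have hev : ∀ᶠ q in 𝓝 (extChartAt 𝓘(ℝ, E) x₀ y),
        (extChartAt 𝓘(ℝ, E) x₀).symm q ∈ (chartAt E y).source := by
      refine hc.eventually ?_
      rw [extChartAt_symm_extChartAt hy]
      exact (chartAt E y).open_source.mem_nhds hyy
    filter_upwards [target_mem_nhds hp, hev] with q hq hqy
    simp only [f]
    rw [formCoord_extChartAt η hqy]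
    ext v
    simp only [formCoord, ContinuousAlternatingMap.compContinuousLinearMap_apply]
    congr 1
    ext i
    simp only [Function.comp]
    rw [hdf q hq hqy, coordSymm_coordL hqy]
  rw [h4.extDeriv_eq, extDeriv_pullback (r := ∞) (by rw [hfy]; exact hη) hf
    (by simpa using ENat.LEInfty.out), h1, hfy]
  ext v
  simp only [ContinuousAlternatingMap.compContinuousLinearMap_apply]
  congr 1
  ext i
  have := hdf _ hp (by rwa [extChartAt_symm_extChartAt hy])
  rw [extChartAt_symm_extChartAt hy] at this
  simp only [Function.comp]
  rw [this]

/-- The alternating map associated with a bilinear map. -/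
def altOfBilin : (E →L[ℝ] E →L[ℝ] ℝ) →ₗ[ℝ] E [⋀^Fin 2]→L[ℝ] ℝ where
  toFun B :=
    -- The factor ½ makes the map return a bilinear form unchanged when that form is already
    -- alternating.
    { toFun := fun v ↦ (1 / 2) * (B (v 0) (v 1) - B (v 1) (v 0))
      map_update_add' := fun v i a b ↦ by
        fin_cases i <;> simp <;> ring
      map_update_smul' := fun v i c a ↦ by
        fin_cases i <;> simp <;> ring
      cont := by fun_prop
      map_eq_zero_of_eq' := fun v i j hv hij ↦ by
        have h01 : v 0 = v 1 := by fin_cases i <;> fin_cases j <;> simp_all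
        simp [h01] }
  map_add' B B' := by
    ext v
    change (1 / 2 : ℝ) * ((B + B') (v 0) (v 1) - (B + B') (v 1) (v 0))
      = (1 / 2) * (B (v 0) (v 1) - B (v 1) (v 0)) + (1 / 2) * (B' (v 0) (v 1) - B' (v 1) (v 0))
    simp only [_root_.add_apply]
    ring
  map_smul' c B := by
    ext v
    change (1 / 2 : ℝ) * ((c • B) (v 0) (v 1) - (c • B) (v 1) (v 0))
      = c * ((1 / 2) * (B (v 0) (v 1) - B (v 1) (v 0)))
    simp only [_root_.smul_apply, smul_eq_mul]
    ring

theorem differentiableAt_linearMap_comp {P G F : Type*} [NormedAddCommGroup P] [NormedSpace ℝ P]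
    [NormedAddCommGroup G] [NormedSpace ℝ G] [FiniteDimensional ℝ G] [NormedAddCommGroup F]
    [NormedSpace ℝ F] (f : G →ₗ[ℝ] F) {B : P → G} {p : P} (hB : DifferentiableAt ℝ B p) :
    DifferentiableAt ℝ (fun q ↦ f (B q)) p :=
  DifferentiableAt.comp (g := f.toContinuousLinearMap) p
    f.toContinuousLinearMap.differentiableAt hB

set_option synthInstance.maxHeartbeats 400000 in
theorem differentiableAt_altOfBilin {G : Type*} [NormedAddCommGroup G] [NormedSpace ℝ G]
    [FiniteDimensional ℝ G] {B : G → G →L[ℝ] G →L[ℝ] ℝ} {q : G} (hB : DifferentiableAt ℝ B q) :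
    DifferentiableAt ℝ (fun q ↦ altOfBilin (B q)) q :=
  differentiableAt_linearMap_comp (G := G →L[ℝ] G →L[ℝ] ℝ) (F := G [⋀^Fin 2]→L[ℝ] ℝ) altOfBilin hB

end Forms

/-! ### The complex structure and dω in a chart -/

section Hermitian

variable {E : Type*} [NormedAddCommGroup E] [NormedSpace ℝ E] [FiniteDimensional ℝ E]
  {M : Type*} [TopologicalSpace M] [ChartedSpace E M] [IsManifold 𝓘(ℝ, E) ∞ M]
  [RiemannianBundle (fun x : M ↦ TangentSpace 𝓘(ℝ, E) x)]
  (h : HermitianStructure E M) {x₀ y : M} {p : E}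

/-- The coordinate expression of the complex structure in the chart at `x₀`. -/
def HermitianStructure.complexCoord (x₀ : M) (p : E) : E →L[ℝ] E :=
  (coordL x₀ ((extChartAt 𝓘(ℝ, E) x₀).symm p)).comp
    ((h.J ((extChartAt 𝓘(ℝ, E) x₀).symm p)).comp (coordSymm x₀ ((extChartAt 𝓘(ℝ, E) x₀).symm p)))

theorem HermitianStructure.contDiffAt_complexCoord
    (hp : p ∈ (extChartAt 𝓘(ℝ, E) x₀).target) : ContDiffAt ℝ ∞ (h.complexCoord x₀) p := by
  have hs := extChartAt_symm_mem hp
  refine contDiffAt_clm_of_apply fun w ↦ ?_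
  refine contDiffAt_comp_symm (f := fun z : M ↦ coordL x₀ z (h.J z (coordSymm x₀ z w))) hp ?_
  exact contMDiffAt_coordL hs
    ((h.contMDiff_J _).clm_bundle_apply (b := id) (contMDiffAt_coordSymm hs w))

/-- The coordinate expression of the fundamental form as a bilinear map. -/
def HermitianStructure.fundamentalCoord (x₀ : M) (p : E) : E →L[ℝ] E →L[ℝ] ℝ :=
  (metricCoord x₀ p).comp (h.complexCoord x₀ p)

theorem HermitianStructure.formCoord_fundamentalForm
    (hp : p ∈ (extChartAt 𝓘(ℝ, E) x₀).target) (v : Fin 2 → E) :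
    formCoord x₀ h.fundamentalForm p v = h.fundamentalCoord x₀ p (v 0) (v 1) := by
  change _ = metricCoord x₀ p (coordL x₀ _ _) (v 1)
  rw [metricCoord_apply, coordSymm_coordL (extChartAt_symm_mem hp)]
  rfl

variable [IsContMDiffRiemannianBundle 𝓘(ℝ, E) ∞ E (fun x : M ↦ TangentSpace 𝓘(ℝ, E) x)]

theorem HermitianStructure.contDiffAt_fundamentalCoord
    (hp : p ∈ (extChartAt 𝓘(ℝ, E) x₀).target) : ContDiffAt ℝ ∞ (h.fundamentalCoord x₀) p :=
  (contDiffAt_metricCoord hp).clm_comp (h.contDiffAt_complexCoord hp)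

/-- Near `p` the form is the image of the smooth bilinear map `fundamentalCoord` under the fixed
linear map `altOfBilin`, which is continuous because its source is finite dimensional. -/
theorem HermitianStructure.differentiableAt_formCoord
    (hp : p ∈ (extChartAt 𝓘(ℝ, E) x₀).target) :
    DifferentiableAt ℝ (formCoord x₀ h.fundamentalForm) p := by
  have h1 := differentiableAt_altOfBilin
    ((h.contDiffAt_fundamentalCoord hp).differentiableAt (by simp))
  refine h1.congr_of_eventuallyEq ?_
  filter_upwards [target_mem_nhds hp] with q hq
  ext v
  have h2 : formCoord x₀ h.fundamentalForm q ![v 1, v 0]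
      = - formCoord x₀ h.fundamentalForm q ![v 0, v 1] := by
    refine Eq.trans ?_
      ((formCoord x₀ h.fundamentalForm q).map_swap ![v 0, v 1] (i := 0) (j := 1) (by simp))
    change formCoord x₀ h.fundamentalForm q _ = formCoord x₀ h.fundamentalForm q _
    congr 1
    ext i
    fin_cases i <;> rfl
  rw [h.formCoord_fundamentalForm hq, h.formCoord_fundamentalForm hq] at h2
  rw [h.formCoord_fundamentalForm hq]
  change _ = (1 / 2 : ℝ) * (_ - _)
  simp only [Matrix.cons_val_zero, Matrix.cons_val_one] at h2
  rw [h2]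
  ring

/-- The exterior derivative of the fundamental form in the chart at `x₀`. -/
theorem HermitianStructure.extDerivForm_fundamentalForm
    (hp : p ∈ (extChartAt 𝓘(ℝ, E) x₀).target) (u v w : E) :
    extDerivForm h.fundamentalForm ((extChartAt 𝓘(ℝ, E) x₀).symm p)
      ![coordSymm x₀ _ u, coordSymm x₀ _ v, coordSymm x₀ _ w]
      = fderiv ℝ (h.fundamentalCoord x₀) p u v w - fderiv ℝ (h.fundamentalCoord x₀) p v u w
        + fderiv ℝ (h.fundamentalCoord x₀) p w u v := by
  have hs := extChartAt_symm_mem hp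
  have h1 := extDerivForm_coordSymm h.fundamentalForm hs
    (h.differentiableAt_formCoord (extChartAt_mem (mem_chart_source E _)))
  rw [(extChartAt 𝓘(ℝ, E) x₀).right_inv hp] at h1
  have h2 := congr($h1 ![u, v, w])
  rw [extDeriv_apply (h.differentiableAt_formCoord hp)] at h2
  have h3 (v : Fin 2 → E) : fderiv ℝ (fun q ↦ formCoord x₀ h.fundamentalForm q v) p
      = (ContinuousLinearMap.apply ℝ ℝ (v 1)).comp
          ((ContinuousLinearMap.apply ℝ (E →L[ℝ] ℝ) (v 0)).comp
            (fderiv ℝ (h.fundamentalCoord x₀) p)) := by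
    have h4 : (fun q ↦ formCoord x₀ h.fundamentalForm q v) =ᶠ[𝓝 p]
        fun q ↦ h.fundamentalCoord x₀ q (v 0) (v 1) := by
      filter_upwards [target_mem_nhds hp] with q hq
      exact h.formCoord_fundamentalForm hq v
    rw [h4.fderiv_eq]
    have hB := ((h.contDiffAt_fundamentalCoord hp).differentiableAt (by simp)).hasFDerivAt
    have h5 := (hB.clm_apply (hasFDerivAt_const (v 0) p)).clm_apply (hasFDerivAt_const (v 1) p)
    simp only [ContinuousLinearMap.comp_zero, zero_add] at h5
    rw [h5.fderiv]
    rfl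
  simp only [h3] at h2
  have h6 : (coordSymm x₀ ((extChartAt 𝓘(ℝ, E) x₀).symm p)) ∘ ![u, v, w]
      = ![coordSymm x₀ _ u, coordSymm x₀ _ v, coordSymm x₀ _ w] := by
    ext i; fin_cases i <;> rfl
  rw [ContinuousAlternatingMap.compContinuousLinearMap_apply, h6] at h2
  refine h2.trans ((Fin.sum_univ_three _).trans ?_)
  simp [Fin.removeNth, Fin.succAbove]
  ring

end Hermitian

/-- The pointwise identity behind the comparison of the two index forms: `G` is a metric with
derivative `dG`, `Γ` its Christoffel symbols, `A` a bilinear map with totally skew `G(A(u, v), w)`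
and derivative `dA`; `v'`, `w'` are the derivatives of `v`, `w` along a curve with velocity `ξ`. -/
theorem index_identity {E : Type*} [NormedAddCommGroup E] [NormedSpace ℝ E]
    (G : E →L[ℝ] E →L[ℝ] ℝ) (Γ A : E →L[ℝ] E →L[ℝ] E) (dG : E →L[ℝ] E →L[ℝ] E →L[ℝ] ℝ)
    (dΓ dA : E →L[ℝ] E →L[ℝ] E →L[ℝ] E)
    (hG : ∀ u w, G u w = G w u) (hΓ : ∀ u w, Γ u w = Γ w u)
    (hdG : ∀ z u w, dG z u w = G (Γ z u) w + G u (Γ z w))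
    (hA : ∀ u w, A u w = - A w u) (hA' : ∀ u v w, G (A u v) w = - G (A u w) v)
    (hdA : ∀ z u, dA z u u = 0)
    (hdA' : ∀ z u v w, dG z (A u v) w + G (dA z u v) w = - (dG z (A u w) v + G (dA z u w) v))
    (ξ v w v' w' : E) :
    dG ξ (A v w) ξ + G (dA ξ v w + A v' w + A v w') ξ + G (A v w) (- Γ ξ ξ) =
      (G (v' + Γ ξ v) (w' + Γ ξ w)
        - G (dΓ v ξ ξ - dΓ ξ v ξ + Γ v (Γ ξ ξ) - Γ ξ (Γ v ξ)) w)
      - (G (v' + (Γ + A) ξ v) (w' + (Γ + A) ξ w)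
        + G ((Γ + A) v ξ - (Γ + A) ξ v) (w' + (Γ + A) ξ w)
        - G ((dΓ + dA) v ξ ξ - (dΓ + dA) ξ v ξ + (Γ + A) v ((Γ + A) ξ ξ)
          - (Γ + A) ξ ((Γ + A) v ξ)) w) := by
  have hA0 (u : E) : A u u = 0 := by
    have := hA u u
    rwa [eq_neg_iff_add_eq_zero, ← two_smul ℝ, smul_eq_zero_iff_right (by norm_num)] at this
  -- `e1` moves the derivative of A onto the pair (v, ξ) that occurs in the curvature; `e2`–`e6` and
  -- `e9`, `e10` match the terms linear in A, and `e7`, `e8` cancel the quadratic ones. What remains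
  -- is linear in these scalars.
  have e1 := hdA' ξ v w ξ
  have e2 := hA' v w (Γ ξ ξ)
  have e3 := hA' ξ w v'
  have e4 := hA' ξ w (Γ ξ v)
  have e5 : G (A v' w) ξ = G (A ξ v') w := by
    rw [hA' v' w ξ, hA v' ξ]; simp
  have e6 : G (A v w') ξ = G (A ξ v) w' := by
    rw [hA' v w' ξ, hA v ξ]; simp
  have e7 := hA' ξ (A ξ v) w
  have e8 := hG (A ξ w) (A ξ v)
  have e9 := hG (A ξ w) v'
  have e10 := hG (A ξ w) (Γ ξ v)
  simp only [hdG] at e1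
  simp only [_root_.add_apply, map_add, map_sub, map_neg, _root_.sub_apply, _root_.neg_apply, hdG,
    hA0, hdA, hΓ v ξ, hA v ξ, map_zero, _root_.zero_apply] at e1 e2 e3 e4 e5 e6 e7 e8 e9 e10 ⊢
  linarith

/-! ### The difference tensor A: smoothness and skew-symmetry -/

section Hermitian

variable {E : Type*} [NormedAddCommGroup E] [NormedSpace ℝ E] [FiniteDimensional ℝ E]
  {M : Type*} [TopologicalSpace M] [ChartedSpace E M] [IsManifold 𝓘(ℝ, E) ∞ M]
  [RiemannianBundle (fun x : M ↦ TangentSpace 𝓘(ℝ, E) x)]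
  [IsContMDiffRiemannianBundle 𝓘(ℝ, E) ∞ E (fun x : M ↦ TangentSpace 𝓘(ℝ, E) x)]
  (h : HermitianStructure E M) {x₀ y : M} {p : E}

/-- The difference of the Strominger-Bismut and the Levi-Civita connection in the chart at `x₀`. -/
def HermitianStructure.bismutCoord (x₀ : M) (p : E) : E →L[ℝ] E →L[ℝ] E :=
  christoffel h.bismut x₀ p - christoffel (leviCivita E M) x₀ p

theorem HermitianStructure.christoffel_bismut (x₀ : M) (p : E) :
    christoffel h.bismut x₀ p = christoffel (leviCivita E M) x₀ p + h.bismutCoord x₀ p := by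
  rw [bismutCoord]
  abel

theorem HermitianStructure.bismutCoord_apply (hp : p ∈ (extChartAt 𝓘(ℝ, E) x₀).target) (u v : E) :
    h.bismutCoord x₀ p u v = coordL x₀ ((extChartAt 𝓘(ℝ, E) x₀).symm p)
      (h.bismutForm _ (coordSymm x₀ _ v) (coordSymm x₀ _ u)) := by
  rw [bismutCoord, _root_.sub_apply, _root_.sub_apply, christoffel_apply _ hp,
    christoffel_apply _ hp, ← map_sub]
  congr 1
  exact add_sub_cancel_left _ _

theorem HermitianStructure.metricCoord_bismutCoord
    (hp : p ∈ (extChartAt 𝓘(ℝ, E) x₀).target) (u v w : E) :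
    metricCoord x₀ p (h.bismutCoord x₀ p u v) w
      = (1 / 2) * extDerivForm h.fundamentalForm ((extChartAt 𝓘(ℝ, E) x₀).symm p)
        ![h.J _ (coordSymm x₀ _ u), h.J _ (coordSymm x₀ _ v), h.J _ (coordSymm x₀ _ w)] := by
  rw [← h.inner_bismutForm, metricCoord_apply, h.bismutCoord_apply hp,
    coordSymm_coordL (extChartAt_symm_mem hp)]

/-- With its index lowered, A becomes a polynomial expression in J and the first derivatives of ω,
which is what makes its smoothness visible. -/
theorem HermitianStructure.metricCoord_bismutCoord_eq_fderiv
    (hp : p ∈ (extChartAt 𝓘(ℝ, E) x₀).target) (u v w : E) :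
    metricCoord x₀ p (h.bismutCoord x₀ p u v) w
      = (1 / 2) * (fderiv ℝ (h.fundamentalCoord x₀) p (h.complexCoord x₀ p u)
            (h.complexCoord x₀ p v) (h.complexCoord x₀ p w)
        - fderiv ℝ (h.fundamentalCoord x₀) p (h.complexCoord x₀ p v)
            (h.complexCoord x₀ p u) (h.complexCoord x₀ p w)
        + fderiv ℝ (h.fundamentalCoord x₀) p (h.complexCoord x₀ p w)
            (h.complexCoord x₀ p u) (h.complexCoord x₀ p v)) := by
  have hJ (w : E) : coordSymm x₀ ((extChartAt 𝓘(ℝ, E) x₀).symm p) (h.complexCoord x₀ p w)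
      = h.J _ (coordSymm x₀ _ w) := coordSymm_coordL (extChartAt_symm_mem hp) _
  rw [h.metricCoord_bismutCoord hp, ← h.extDerivForm_fundamentalForm hp, hJ, hJ, hJ]

set_option synthInstance.maxHeartbeats 400000 in
theorem HermitianStructure.contDiffAt_bismutCoord (hp : p ∈ (extChartAt 𝓘(ℝ, E) x₀).target) :
    ContDiffAt ℝ ∞ (h.bismutCoord x₀) p := by
  refine contDiffAt_of_metricCoord hp fun u v w ↦ ?_
  have hJ (u : E) : ContDiffAt ℝ ∞ (fun q ↦ h.complexCoord x₀ q u) p :=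
    (h.contDiffAt_complexCoord hp).clm_apply contDiffAt_const
  have hB (u v w : E) := contDiffAt_fderiv_apply (h.contDiffAt_fundamentalCoord hp)
    (hJ u) (hJ v) (hJ w)
  refine ((((hB u v w).sub (hB v u w)).add (hB w u v)).const_smul
    (1 / 2 : ℝ)).congr_of_eventuallyEq ?_
  filter_upwards [target_mem_nhds hp] with q hq
  exact h.metricCoord_bismutCoord_eq_fderiv hq u v w

set_option synthInstance.maxHeartbeats 400000 in
-- dω changes sign under a transposition of its first two arguments, and the metric is
-- nondegenerate.
theorem HermitianStructure.bismutCoord_swap (hp : p ∈ (extChartAt 𝓘(ℝ, E) x₀).target) (u v : E) :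
    h.bismutCoord x₀ p u v = - h.bismutCoord x₀ p v u := by
  apply metricCoord_injective hp
  ext w
  rw [map_neg, _root_.neg_apply, h.metricCoord_bismutCoord hp, h.metricCoord_bismutCoord hp,
    ← mul_neg]
  congr 1
  refine Eq.trans ?_ ((extDerivForm h.fundamentalForm _).map_swap
    ![h.J _ (coordSymm x₀ _ v), h.J _ (coordSymm x₀ _ u), h.J _ (coordSymm x₀ _ w)]
    (i := 0) (j := 1) (by simp))
  change extDerivForm h.fundamentalForm _ _ = extDerivForm h.fundamentalForm _ _
  congr 1
  ext i
  fin_cases i <;> rfl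

theorem HermitianStructure.metricCoord_bismutCoord_swap
    (hp : p ∈ (extChartAt 𝓘(ℝ, E) x₀).target) (u v w : E) :
    metricCoord x₀ p (h.bismutCoord x₀ p u v) w
      = - metricCoord x₀ p (h.bismutCoord x₀ p u w) v := by
  rw [h.metricCoord_bismutCoord hp, h.metricCoord_bismutCoord hp, ← mul_neg]
  congr 1
  refine Eq.trans ?_ ((extDerivForm h.fundamentalForm _).map_swap
    ![h.J _ (coordSymm x₀ _ u), h.J _ (coordSymm x₀ _ w), h.J _ (coordSymm x₀ _ v)]
    (i := 1) (j := 2) (by simp))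
  change extDerivForm h.fundamentalForm _ _ = extDerivForm h.fundamentalForm _ _
  congr 1
  ext i
  fin_cases i <;> rfl

set_option synthInstance.maxHeartbeats 400000 in
-- A(u,u) vanishes throughout the chart, hence so does its derivative for constant u.
theorem HermitianStructure.fderiv_bismutCoord_self (hp : p ∈ (extChartAt 𝓘(ℝ, E) x₀).target)
    (z u : E) : fderiv ℝ (h.bismutCoord x₀) p z u u = 0 := by
  have hA := ((h.contDiffAt_bismutCoord hp).differentiableAt (by simp)).hasFDerivAt
  have h1 := (hA.clm_apply (hasFDerivAt_const u p)).clm_apply (hasFDerivAt_const u p)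
  simp only [ContinuousLinearMap.comp_zero, zero_add] at h1
  have h2 : (fun q ↦ h.bismutCoord x₀ q u u) =ᶠ[𝓝 p] fun _ ↦ 0 := by
    filter_upwards [target_mem_nhds hp] with q hq
    have := h.bismutCoord_swap hq u u
    rwa [eq_neg_iff_add_eq_zero, ← two_smul ℝ, smul_eq_zero_iff_right (by norm_num)] at this
  have h3 := h1.fderiv.symm.trans h2.fderiv_eq
  rw [fderiv_const_apply] at h3
  exact congr($h3 z)

set_option synthInstance.maxHeartbeats 400000 in
theorem HermitianStructure.fderiv_metricCoord_bismutCoord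
    (hp : p ∈ (extChartAt 𝓘(ℝ, E) x₀).target) (z u v w : E) :
    fderiv ℝ (fun q ↦ metricCoord x₀ q (h.bismutCoord x₀ q u v) w) p z
      = fderiv ℝ (metricCoord x₀) p z (h.bismutCoord x₀ p u v) w
        + metricCoord x₀ p (fderiv ℝ (h.bismutCoord x₀) p z u v) w := by
  have hA := ((h.contDiffAt_bismutCoord (x₀ := x₀) hp).differentiableAt (by simp)).hasFDerivAt
  have hG := ((contDiffAt_metricCoord (x₀ := x₀) hp).differentiableAt (by simp)).hasFDerivAt
  have h1 := (hA.clm_apply (hasFDerivAt_const u p)).clm_apply (hasFDerivAt_const v p)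
  have h2 := (hG.clm_apply h1).clm_apply (hasFDerivAt_const w p)
  rw [h2.fderiv]
  simp [add_comm]

set_option synthInstance.maxHeartbeats 400000 in
-- Obtained by differentiating the skewness of G(A(u,v),w) in v and w; the derivative of G appears
-- because both G and A vary with the point.
theorem HermitianStructure.fderiv_metricCoord_bismutCoord_swap
    (hp : p ∈ (extChartAt 𝓘(ℝ, E) x₀).target) (z u v w : E) :
    fderiv ℝ (metricCoord x₀) p z (h.bismutCoord x₀ p u v) w
        + metricCoord x₀ p (fderiv ℝ (h.bismutCoord x₀) p z u v) w
      = - (fderiv ℝ (metricCoord x₀) p z (h.bismutCoord x₀ p u w) v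
        + metricCoord x₀ p (fderiv ℝ (h.bismutCoord x₀) p z u w) v) := by
  rw [← h.fderiv_metricCoord_bismutCoord hp, ← h.fderiv_metricCoord_bismutCoord hp]
  have h2 : (fun q ↦ metricCoord x₀ q (h.bismutCoord x₀ q u v) w) =ᶠ[𝓝 p]
      fun q ↦ - metricCoord x₀ q (h.bismutCoord x₀ q u w) v := by
    filter_upwards [target_mem_nhds hp] with q hq
    exact h.metricCoord_bismutCoord_swap hq u v w
  rw [h2.fderiv_eq, fderiv_fun_neg]
  rfl

end Hermitian

/-! ### Calculus of coordinate expressions along a curve -/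

section Model

variable {E F : Type*} [NormedAddCommGroup E] [NormedSpace ℝ E]
  [NormedAddCommGroup F] [NormedSpace ℝ F] {s : Set ℝ} {t : ℝ} {x : ℝ → E}

theorem contDiffWithinAt_bilin_apply {B : ℝ → E →L[ℝ] E →L[ℝ] F} {u v : ℝ → E}
    (hB : ContDiffWithinAt ℝ ∞ B s t) (hu : ContDiffWithinAt ℝ ∞ u s t)
    (hv : ContDiffWithinAt ℝ ∞ v s t) : ContDiffWithinAt ℝ ∞ (fun r ↦ B r (u r) (v r)) s t :=
  (hB.clm_apply hu).clm_apply hv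

theorem contDiffWithinAt_fderiv_comp_apply {f : E → F} {u : ℝ → E}
    (hf : ContDiffAt ℝ ∞ f (x t)) (hx : ContDiffWithinAt ℝ ∞ x s t)
    (hu : ContDiffWithinAt ℝ ∞ u s t) :
    ContDiffWithinAt ℝ ∞ (fun r ↦ fderiv ℝ f (x r) (u r)) s t :=
  ((hf.fderiv_right (m := ∞) (by simp)).comp_contDiffWithinAt t hx).clm_apply hu

theorem contDiffWithinAt_curvatureCoord [FiniteDimensional ℝ E] {Γ : E → E →L[ℝ] E →L[ℝ] E}
    {u v w : ℝ → E}
    (hΓ : ContDiffAt ℝ ∞ Γ (x t)) (hx : ContDiffWithinAt ℝ ∞ x s t)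
    (hu : ContDiffWithinAt ℝ ∞ u s t) (hv : ContDiffWithinAt ℝ ∞ v s t)
    (hw : ContDiffWithinAt ℝ ∞ w s t) :
    ContDiffWithinAt ℝ ∞ (fun r ↦ curvatureCoord Γ (x r) (u r) (v r) (w r)) s t := by
  have h0 : ContDiffWithinAt ℝ ∞ (fun r ↦ Γ (x r)) s t := hΓ.comp_contDiffWithinAt t hx
  have h2 {u v w : ℝ → E} (hu : ContDiffWithinAt ℝ ∞ u s t) (hv : ContDiffWithinAt ℝ ∞ v s t)
      (hw : ContDiffWithinAt ℝ ∞ w s t) :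
      ContDiffWithinAt ℝ ∞ (fun r ↦ fderiv ℝ Γ (x r) (u r) (v r) (w r)) s t :=
    contDiffWithinAt_bilin_apply (contDiffWithinAt_fderiv_comp_apply hΓ hx hu) hv hw
  exact (((h2 hu hv hw).sub (h2 hv hu hw)).add (contDiffWithinAt_bilin_apply h0 hu
    (contDiffWithinAt_bilin_apply h0 hv hw))).sub (contDiffWithinAt_bilin_apply h0 hv
    (contDiffWithinAt_bilin_apply h0 hu hw))

theorem hasDerivWithinAt_comp_of_differentiableAt {f : E → F} {x' : E}
    (hf : DifferentiableAt ℝ f (x t)) (hx : HasDerivWithinAt x x' s t) :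
    HasDerivWithinAt (fun r ↦ f (x r)) (fderiv ℝ f (x t) x') s t :=
  hf.hasFDerivAt.comp_hasDerivWithinAt t hx

set_option synthInstance.maxHeartbeats 400000 in
theorem hasDerivWithinAt_bilin_comp_apply {B : E → E →L[ℝ] E →L[ℝ] F} {u v : ℝ → E} {x' u' v' : E}
    (hB : DifferentiableAt ℝ B (x t)) (hx : HasDerivWithinAt x x' s t)
    (hu : HasDerivWithinAt u u' s t) (hv : HasDerivWithinAt v v' s t) :
    HasDerivWithinAt (fun r ↦ B (x r) (u r) (v r))
      (fderiv ℝ B (x t) x' (u t) (v t) + B (x t) u' (v t) + B (x t) (u t) v') s t := by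
  have h1 := hasDerivWithinAt_comp_of_differentiableAt (F := E →L[ℝ] E →L[ℝ] F) (f := B) hB hx
  have h2 := (h1.clm_apply hu).clm_apply hv
  rwa [_root_.add_apply] at h2

theorem contDiffWithinAt_derivWithin_Icc {a b : ℝ} {f : ℝ → E} (hab : a < b) (ht : t ∈ Icc a b)
    (hf : ContDiffWithinAt ℝ ∞ f (Icc a b) t) :
    ContDiffWithinAt ℝ ∞ (derivWithin f (Icc a b)) (Icc a b) t :=
  hf.derivWithin (uniqueDiffOn_Icc hab) (by simp) ht

end Model

/-! ### Comparison of the two integrands and integration -/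

section Curves

variable {E : Type*} [NormedAddCommGroup E] [NormedSpace ℝ E] [FiniteDimensional ℝ E]
  {M : Type*} [TopologicalSpace M] [ChartedSpace E M] [IsManifold 𝓘(ℝ, E) ∞ M]
  [RiemannianBundle (fun x : M ↦ TangentSpace 𝓘(ℝ, E) x)]
  [IsContMDiffRiemannianBundle 𝓘(ℝ, E) ∞ E (fun x : M ↦ TangentSpace 𝓘(ℝ, E) x)]
  {x₀ : M} {γ : ℝ → M} {a b t : ℝ} {V W : Π t : ℝ, TangentSpace 𝓘(ℝ, E) (γ t)}

/-- The integrand of the index form in the chart at `x₀`. -/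
theorem indexIntegrand_eq (hab : a < b) (hγ : ContMDiffOn 𝓘(ℝ, ℝ) 𝓘(ℝ, E) ∞ γ (Icc a b))
    (hV : IsSmoothAlong γ a b V) (hW : IsSmoothAlong γ a b W) (ht : t ∈ Icc a b)
    (hs : γ t ∈ (chartAt E x₀).source) :
    indexIntegrand γ a b V W t =
      metricCoord x₀ (curveCoord x₀ γ t)
        (derivWithin (fieldCoord x₀ γ V) (Icc a b) t
          + christoffel (leviCivita E M) x₀ (curveCoord x₀ γ t)
            (derivWithin (curveCoord x₀ γ) (Icc a b) t) (fieldCoord x₀ γ V t))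
        (derivWithin (fieldCoord x₀ γ W) (Icc a b) t
          + christoffel (leviCivita E M) x₀ (curveCoord x₀ γ t)
            (derivWithin (curveCoord x₀ γ) (Icc a b) t) (fieldCoord x₀ γ W t))
      - metricCoord x₀ (curveCoord x₀ γ t)
        (curvatureCoord (christoffel (leviCivita E M) x₀) (curveCoord x₀ γ t)
          (fieldCoord x₀ γ V t) (derivWithin (curveCoord x₀ γ) (Icc a b) t)
          (derivWithin (curveCoord x₀ γ) (Icc a b) t)) (fieldCoord x₀ γ W t) := by
  have hΓ := (contDiffAt_christoffel_leviCivita (extChartAt_mem (E := E) hs)).differentiableAt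
    (by simp)
  have hV' := (contDiffWithinAt_fieldCoord hγ hV ht hs).differentiableWithinAt (by simp)
  have hW' := (contDiffWithinAt_fieldCoord hγ hW ht hs).differentiableWithinAt (by simp)
  rw [indexIntegrand, curvatureTensor, ← metricCoord_coordL hs, ← metricCoord_coordL hs,
    coordL_curvature _ hs hΓ, coordL_covDerivAlong _ hab hγ ht hs hV',
    coordL_covDerivAlong _ hab hγ ht hs hW', coordL_velocity hab hγ ht hs]
  rfl

/-- Continuity is local, and in the chart at `γ t` the integrand is assembled from smooth coordinate
data. -/
theorem continuousOn_indexIntegrand (hab : a < b)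
    (hγ : ContMDiffOn 𝓘(ℝ, ℝ) 𝓘(ℝ, E) ∞ γ (Icc a b))
    (hV : IsSmoothAlong γ a b V) (hW : IsSmoothAlong γ a b W) :
    ContinuousOn (indexIntegrand γ a b V W) (Icc a b) := by
  intro t ht
  have hs := mem_chart_source E (γ t)
  have hp := extChartAt_mem (E := E) hs
  have hx := contDiffWithinAt_curveCoord hγ ht hs
  have hv := contDiffWithinAt_fieldCoord hγ hV ht hs
  have hw := contDiffWithinAt_fieldCoord hγ hW ht hs
  have hx' := contDiffWithinAt_derivWithin_Icc hab ht hx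
  have hΓ := contDiffAt_christoffel_leviCivita hp
  have hG := (contDiffAt_metricCoord hp).comp_contDiffWithinAt t hx
  have hΓx := hΓ.comp_contDiffWithinAt t hx
  have h := (contDiffWithinAt_bilin_apply hG
    ((contDiffWithinAt_derivWithin_Icc hab ht hv).add (contDiffWithinAt_bilin_apply hΓx hx' hv))
    ((contDiffWithinAt_derivWithin_Icc hab ht hw).add
      (contDiffWithinAt_bilin_apply hΓx hx' hw))).sub
    (contDiffWithinAt_bilin_apply hG (contDiffWithinAt_curvatureCoord hΓ hx hv hx' hx') hw)
  refine (h.congr_of_eventuallyEq_of_mem ?_ ht).continuousWithinAt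
  filter_upwards [eventually_mem_source hγ ht hs, self_mem_nhdsWithin] with r hr hr'
  exact indexIntegrand_eq hab hγ hV hW hr' hr

variable (h : HermitianStructure E M)

set_option synthInstance.maxHeartbeats 400000 in
theorem HermitianStructure.fderiv_christoffel_bismut {p : E}
    (hp : p ∈ (extChartAt 𝓘(ℝ, E) x₀).target) :
    HasFDerivAt (christoffel h.bismut x₀) (fderiv ℝ (christoffel (leviCivita E M) x₀) p
      + fderiv ℝ (h.bismutCoord x₀) p) p := by
  have h1 := ((contDiffAt_christoffel_leviCivita hp).differentiableAt (by simp)).hasFDerivAt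
  have h2 := ((h.contDiffAt_bismutCoord hp).differentiableAt (by simp)).hasFDerivAt
  exact (h1.add h2).congr_of_eventuallyEq (.of_forall (h.christoffel_bismut x₀))

/-- The symmetric Levi-Civita part drops out of the torsion, while the skew part A is counted twice;
the factor ½ undoes the doubling. -/
theorem HermitianStructure.torsionTensor_bismut {y : M} (hs : y ∈ (chartAt E x₀).source)
    (u v w : TangentSpace 𝓘(ℝ, E) y) :
    (1 / 2) * torsionTensor h.bismut y u v w =
      metricCoord x₀ (extChartAt 𝓘(ℝ, E) x₀ y)
        (h.bismutCoord x₀ (extChartAt 𝓘(ℝ, E) x₀ y) (coordL x₀ y u) (coordL x₀ y v))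
        (coordL x₀ y w) := by
  have hp := extChartAt_mem (E := E) hs
  rw [torsionTensor, ← metricCoord_coordL hs, coordL_torsion _ hs, h.christoffel_bismut,
    _root_.add_apply, _root_.add_apply, _root_.add_apply, _root_.add_apply,
    christoffel_leviCivita_comm hp, h.bismutCoord_swap hp (coordL x₀ y v),
    add_sub_add_left_eq_sub, sub_neg_eq_add, map_add, _root_.add_apply]
  ring

theorem HermitianStructure.bismutIntegrand_eq (hab : a < b)
    (hγ : ContMDiffOn 𝓘(ℝ, ℝ) 𝓘(ℝ, E) ∞ γ (Icc a b))
    (hV : IsSmoothAlong γ a b V) (hW : IsSmoothAlong γ a b W) (ht : t ∈ Icc a b)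
    (hs : γ t ∈ (chartAt E x₀).source) :
    h.bismutIntegrand γ a b V W t =
      metricCoord x₀ (curveCoord x₀ γ t)
        (derivWithin (fieldCoord x₀ γ V) (Icc a b) t
          + christoffel h.bismut x₀ (curveCoord x₀ γ t)
            (derivWithin (curveCoord x₀ γ) (Icc a b) t) (fieldCoord x₀ γ V t))
        (derivWithin (fieldCoord x₀ γ W) (Icc a b) t
          + christoffel h.bismut x₀ (curveCoord x₀ γ t)
            (derivWithin (curveCoord x₀ γ) (Icc a b) t) (fieldCoord x₀ γ W t))
      + metricCoord x₀ (curveCoord x₀ γ t)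
        (christoffel h.bismut x₀ (curveCoord x₀ γ t) (fieldCoord x₀ γ V t)
            (derivWithin (curveCoord x₀ γ) (Icc a b) t)
          - christoffel h.bismut x₀ (curveCoord x₀ γ t)
            (derivWithin (curveCoord x₀ γ) (Icc a b) t) (fieldCoord x₀ γ V t))
        (derivWithin (fieldCoord x₀ γ W) (Icc a b) t
          + christoffel h.bismut x₀ (curveCoord x₀ γ t)
            (derivWithin (curveCoord x₀ γ) (Icc a b) t) (fieldCoord x₀ γ W t))
      - metricCoord x₀ (curveCoord x₀ γ t)
        (curvatureCoord (christoffel h.bismut x₀) (curveCoord x₀ γ t)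
          (fieldCoord x₀ γ V t) (derivWithin (curveCoord x₀ γ) (Icc a b) t)
          (derivWithin (curveCoord x₀ γ) (Icc a b) t)) (fieldCoord x₀ γ W t) := by
  have hΓ := (h.fderiv_christoffel_bismut (extChartAt_mem (E := E) hs)).differentiableAt
  have hV' := (contDiffWithinAt_fieldCoord hγ hV ht hs).differentiableWithinAt (by simp)
  have hW' := (contDiffWithinAt_fieldCoord hγ hW ht hs).differentiableWithinAt (by simp)
  rw [bismutIntegrand, curvatureTensor, torsionTensor, ← metricCoord_coordL hs,
    ← metricCoord_coordL hs, ← metricCoord_coordL hs, coordL_torsion _ hs,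
    coordL_curvature _ hs hΓ, coordL_covDerivAlong _ hab hγ ht hs hV',
    coordL_covDerivAlong _ hab hγ ht hs hW', coordL_velocity hab hγ ht hs]
  rfl

theorem HermitianStructure.torsionTensor_velocity (hab : a < b)
    (hγ : ContMDiffOn 𝓘(ℝ, ℝ) 𝓘(ℝ, E) ∞ γ (Icc a b)) (ht : t ∈ Icc a b)
    (hs : γ t ∈ (chartAt E x₀).source) :
    (1 / 2) * torsionTensor h.bismut (γ t) (V t) (W t) (velocity γ a b t) =
      metricCoord x₀ (curveCoord x₀ γ t) (h.bismutCoord x₀ (curveCoord x₀ γ t)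
        (fieldCoord x₀ γ V t) (fieldCoord x₀ γ W t))
        (derivWithin (curveCoord x₀ γ) (Icc a b) t) := by
  rw [h.torsionTensor_bismut hs, coordL_velocity hab hγ ht hs]
  rfl

theorem HermitianStructure.contDiffOn_torsionTensor_velocity (hab : a < b)
    (hγ : ContMDiffOn 𝓘(ℝ, ℝ) 𝓘(ℝ, E) ∞ γ (Icc a b))
    (hV : IsSmoothAlong γ a b V) (hW : IsSmoothAlong γ a b W) :
    ContDiffOn ℝ ∞ (fun t ↦ (1 / 2) * torsionTensor h.bismut (γ t) (V t) (W t) (velocity γ a b t))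
      (Icc a b) := by
  intro t ht
  have hs := mem_chart_source E (γ t)
  have hp := extChartAt_mem (E := E) hs
  have hx := contDiffWithinAt_curveCoord hγ ht hs
  have hv := contDiffWithinAt_fieldCoord hγ hV ht hs
  have hw := contDiffWithinAt_fieldCoord hγ hW ht hs
  have hx' := contDiffWithinAt_derivWithin_Icc hab ht hx
  have hG := (contDiffAt_metricCoord hp).comp_contDiffWithinAt t hx
  have hA := (h.contDiffAt_bismutCoord hp).comp_contDiffWithinAt t hx
  refine (contDiffWithinAt_bilin_apply hG
    (contDiffWithinAt_bilin_apply hA hv hw) hx').congr_of_eventuallyEq_of_mem ?_ ht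
  filter_upwards [eventually_mem_source hγ ht hs, self_mem_nhdsWithin] with r hr hr'
  exact h.torsionTensor_velocity hab hγ hr' hr

/-- The geodesic equation in the chart at `x₀`. -/
theorem IsUnitSpeedGeodesic.hasDerivWithinAt_derivWithin_curveCoord (hab : a < b)
    (hγ : IsUnitSpeedGeodesic (E := E) γ a b) (ht : t ∈ Icc a b)
    (hs : γ t ∈ (chartAt E x₀).source) :
    HasDerivWithinAt (derivWithin (curveCoord (E := E) x₀ γ) (Icc a b))
      (- christoffel (leviCivita E M) x₀ (curveCoord x₀ γ t)
        (derivWithin (curveCoord x₀ γ) (Icc a b) t)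
        (derivWithin (curveCoord x₀ γ) (Icc a b) t)) (Icc a b) t := by
  have hx' := contDiffWithinAt_derivWithin_Icc hab ht
    (contDiffWithinAt_curveCoord hγ.contMDiffOn ht hs)
  have heq : fieldCoord x₀ γ (velocity γ a b) =ᶠ[𝓝[Icc a b] t]
      derivWithin (curveCoord (E := E) x₀ γ) (Icc a b) := by
    filter_upwards [eventually_mem_source hγ.contMDiffOn ht hs, self_mem_nhdsWithin] with r hr hr'
    exact coordL_velocity hab hγ.contMDiffOn hr' hr
  have hd := hx'.differentiableWithinAt (by simp)
  have h1 := coordL_covDerivAlong (leviCivita E M) hab hγ.contMDiffOn ht hs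
    (hd.congr_of_eventuallyEq heq (heq.self_of_nhdsWithin ht))
  rw [hγ.geodesic t ht, heq.derivWithin_eq (heq.self_of_nhdsWithin ht),
    heq.self_of_nhdsWithin ht, map_zero] at h1
  rw [← eq_neg_of_add_eq_zero_left h1.symm]
  exact hd.hasDerivWithinAt

/-- The product rule differentiates G(A(V,W),γ'), the geodesic equation replaces γ'' by −Γ(γ',γ'),
and `index_identity` recognises the result. -/
theorem HermitianStructure.derivWithin_torsionTensor_velocity (hab : a < b)
    (hγ : IsUnitSpeedGeodesic (E := E) γ a b)
    (hV : IsSmoothAlong γ a b V) (hW : IsSmoothAlong γ a b W) (ht : t ∈ Icc a b) :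
    derivWithin (fun t ↦ (1 / 2) * torsionTensor h.bismut (γ t) (V t) (W t) (velocity γ a b t))
      (Icc a b) t = indexIntegrand γ a b V W t - h.bismutIntegrand γ a b V W t := by
  have hs := mem_chart_source E (γ t)
  have hp : curveCoord (γ t) γ t ∈ (extChartAt 𝓘(ℝ, E) (γ t)).target := extChartAt_mem hs
  have hx := ((contDiffWithinAt_curveCoord hγ.contMDiffOn ht hs).differentiableWithinAt
    (by simp)).hasDerivWithinAt
  have hv := ((contDiffWithinAt_fieldCoord hγ.contMDiffOn hV ht hs).differentiableWithinAt
    (by simp)).hasDerivWithinAt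
  have hw := ((contDiffWithinAt_fieldCoord hγ.contMDiffOn hW ht hs).differentiableWithinAt
    (by simp)).hasDerivWithinAt
  have hd := hasDerivWithinAt_bilin_comp_apply ((contDiffAt_metricCoord hp).differentiableAt
      (by simp)) hx
    (hasDerivWithinAt_bilin_comp_apply ((h.contDiffAt_bismutCoord hp).differentiableAt (by simp))
      hx hv hw)
    (hγ.hasDerivWithinAt_derivWithin_curveCoord hab ht hs)
  have heq : (fun t ↦ (1 / 2) * torsionTensor h.bismut (γ t) (V t) (W t) (velocity γ a b t))
      =ᶠ[𝓝[Icc a b] t] fun r ↦ metricCoord (γ t) (curveCoord (γ t) γ r)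
        (h.bismutCoord (γ t) (curveCoord (γ t) γ r) (fieldCoord (γ t) γ V r)
          (fieldCoord (γ t) γ W r)) (derivWithin (curveCoord (γ t) γ) (Icc a b) r) := by
    filter_upwards [eventually_mem_source hγ.contMDiffOn ht hs, self_mem_nhdsWithin] with r hr hr'
    exact h.torsionTensor_velocity hab hγ.contMDiffOn hr' hr
  rw [(hd.congr_of_eventuallyEq_of_mem heq ht).derivWithin (uniqueDiffOn_Icc hab t ht),
    indexIntegrand_eq hab hγ.contMDiffOn hV hW ht hs,
    h.bismutIntegrand_eq hab hγ.contMDiffOn hV hW ht hs]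
  have key := index_identity (metricCoord (γ t) (curveCoord (γ t) γ t))
    (christoffel (leviCivita E M) (γ t) (curveCoord (γ t) γ t))
    (h.bismutCoord (γ t) (curveCoord (γ t) γ t)) _
    (fderiv ℝ (christoffel (leviCivita E M) (γ t)) (curveCoord (γ t) γ t)) _
    (metricCoord_comm _ _) (christoffel_leviCivita_comm hp) (fderiv_metricCoord hp)
    (h.bismutCoord_swap hp) (h.metricCoord_bismutCoord_swap hp) (h.fderiv_bismutCoord_self hp)
    (h.fderiv_metricCoord_bismutCoord_swap hp)
    (derivWithin (curveCoord (γ t) γ) (Icc a b) t) (fieldCoord (γ t) γ V t)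
    (fieldCoord (γ t) γ W t) (derivWithin (fieldCoord (γ t) γ V) (Icc a b) t)
    (derivWithin (fieldCoord (γ t) γ W) (Icc a b) t)
  simp only [curvatureCoord]
  rw [(h.fderiv_christoffel_bismut hp).fderiv, h.christoffel_bismut]
  exact key

/-- The two index forms on `[a, b]` differ by a boundary term. -/
theorem HermitianStructure.indexForm_eq (hab : a < b)
    (hγ : IsUnitSpeedGeodesic (E := E) γ a b)
    (hV : IsSmoothAlong γ a b V) (hW : IsSmoothAlong γ a b W) :
    IntervalIntegrable (indexIntegrand γ a b V W) volume a b ∧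
    IntervalIntegrable (h.bismutIntegrand γ a b V W) volume a b ∧
    indexForm γ a b V W =
      (∫ t in a..b, h.bismutIntegrand γ a b V W t)
        + ((1 / 2) * torsionTensor h.bismut (γ b) (V b) (W b) (velocity γ a b b)
          - (1 / 2) * torsionTensor h.bismut (γ a) (V a) (W a) (velocity γ a b a)) := by
  have hF := h.contDiffOn_torsionTensor_velocity hab hγ.contMDiffOn hV hW
  have hc := continuousOn_indexIntegrand hab hγ.contMDiffOn hV hW
  have hd := hF.continuousOn_derivWithin (uniqueDiffOn_Icc hab) (by simp)
  -- No separate coordinate argument is needed: this integrand is the other one minus the continuous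
  -- derivative of the boundary function.
  have hB : ContinuousOn (h.bismutIntegrand γ a b V W) (Icc a b) :=
    (hc.sub hd).congr fun t ht ↦ by
      rw [Pi.sub_apply, h.derivWithin_torsionTensor_velocity hab hγ hV hW ht, sub_sub_cancel]
  rw [← uIcc_of_le hab.le] at hc hB
  refine ⟨hc.intervalIntegrable, hB.intervalIntegrable, ?_⟩
  have hI := intervalIntegral.integral_derivWithin_Icc_of_contDiffOn_Icc
    (hF.of_le (by simp)) hab.le
  rw [← hI, indexForm, ← sub_eq_iff_eq_add', ← intervalIntegral.integral_sub
    hc.intervalIntegrable hB.intervalIntegrable]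
  refine intervalIntegral.integral_congr fun t ht ↦ ?_
  rw [uIcc_of_le hab.le] at ht
  exact (h.derivWithin_torsionTensor_velocity hab hγ hV hW ht).symm

end Curves

end

end HermitianGeometry

theorem theorem1p2 {E : Type*} [NormedAddCommGroup E] [NormedSpace ℝ E] [FiniteDimensional ℝ E]
    {M : Type*} [TopologicalSpace M] [ChartedSpace E M] [IsManifold 𝓘(ℝ, E) ∞ M]
    [RiemannianBundle (fun x : M ↦ TangentSpace 𝓘(ℝ, E) x)]
    [IsContMDiffRiemannianBundle 𝓘(ℝ, E) ∞ E (fun x : M ↦ TangentSpace 𝓘(ℝ, E) x)]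
    (h : HermitianStructure E M) {a b : ℝ} (hab : a < b) (γ : ℝ → M)
    (hγ : IsUnitSpeedGeodesic (E := E) γ a b)
    (V W : Π t : ℝ, TangentSpace 𝓘(ℝ, E) (γ t))
    (hV : IsSmoothAlong γ a b V) (hW : IsSmoothAlong γ a b W) :
    IntervalIntegrable (indexIntegrand γ a b V W) volume a b ∧
    IntervalIntegrable (h.bismutIntegrand γ a b V W) volume a b ∧
    indexForm γ a b V W =
      (∫ t in a..b, h.bismutIntegrand γ a b V W t)
        + ((1 / 2) * torsionTensor h.bismut (γ b) (V b) (W b) (velocity γ a b b)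
          - (1 / 2) * torsionTensor h.bismut (γ a) (V a) (W a) (velocity γ a b a)) ∧
    indexForm γ a b V V = ∫ t in a..b, h.bismutIntegrand γ a b V V t := by
  obtain ⟨h1, h2, h3⟩ := h.indexForm_eq hab hγ hV hW
  refine ⟨h1, h2, h3, ?_⟩
  -- For W = V the boundary term disappears because the torsion is skew in its first two arguments.
  have h4 (t : ℝ) (w : TangentSpace 𝓘(ℝ, E) (γ t)) :
      torsionTensor h.bismut (γ t) (V t) (V t) w = 0 := by
    rw [torsionTensor, CovariantDerivative.torsion_self, inner_zero_left]
  rw [(h.indexForm_eq hab hγ hV hV).2.2, h4, h4]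
  simp
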